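/- Let $\lambda>0$, let $\alpha\in\mathbb{R}\setminus\mathbb{Q}$, let $\theta\in\mathbb{R}$ with $\theta\notin \tfrac12+\alpha\mathbb{Z}+\mathbb{Z}$, and let $e\in\mathbb{R}$. For $u:\mathbb{Z}\to\mathbb{C}$ put $$(h_{\lambda,\alpha,\theta}u)_n=u_{n+1}+u_{n-1}+\lambda\tan(\pi(\theta+n\alpha))\,u_n .$$ Let $p_n/q_n$ be the continued fraction approximants of $\alpha$, let $\|x\|_{\mathbb{R}/\mathbb{Z}}=\min_{\ell\in\mathbb{Z}}|x-\ell|$, and set, with $\ln 0=-\infty$, $$\delta(\alpha,\theta)=\limsup_{n\to\infty}\frac{\ln\|q_n(\theta-\frac12)\|_{\mathbb{R}/\mathbb{Z}}+\ln q_{n+1}}{q_n}\in[-\infty,\infty].$$ Let $\gamma_\lambda(e)=\lim_{n\to\infty}\frac1n\int_0^1\ln\|A(x+(n-1)\alpha)\cdots A(x+\alpha)A(x)\|\,dx$ be the Lyapunov exponent, where $A(x)=\begin{pmatrix} e-\lambda\tan\pi x&-1\\1&0\end{pmatrix}$ and $\|\cdot\|$ is the Euclidean operator norm. Let $k_\lambda(e)$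 be the integrated density of states, $$k_\lambda(e)=\lim_{N\to\infty}\frac1N\int_0^1 \#\{\text{eigenvalues}\le e\text{ of } h^{(N)}_{\lambda,\alpha,x}\}\,dx ,$$ where $h^{(N)}_{\lambda,\alpha,x}$ is the restriction of $h_{\lambda,\alpha,x}$ to the sites $0,\dots,N-1$ with Dirichlet boundary conditions, and eigenvalues are counted with multiplicity. Suppose that $\gamma_\lambda(e)>\delta(\alpha,\theta)$ and that $h_{\lambda,\alpha,\theta}u=eu$ has a solution $u\neq0$ which is polynomially bounded, that is, for some constant $C$, $|u_n|\le C(1+|n|^{C})$ for all $n\in\mathbb{Z}$. Then $e$ satisfies the quantization condition $$k_\lambda(e)\in\theta+\tfrac12+\alpha\mathbb{Z}+\mathbb{Z}.$$ -/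

import Mathlib

/-- The Maryland operator `(h u)_n = u_{n+1} + u_{n-1} + lam * tan (π (θ + n α)) * u_n`,
acting on arbitrary sequences. -/
noncomputable def marylandOp (lam α θ : ℝ) (u : ℤ → ℂ) : ℤ → ℂ := fun n =>
  u (n + 1) + u (n - 1) + ((lam * Real.tan (Real.pi * (θ + n * α)) : ℝ) : ℂ) * u n

/-- The class of polynomially bounded sequences: `|u_n| ≤ C (1 + |n| ^ C)` for some `C`. -/
def PolynomiallyBounded (u : ℤ → ℂ) : Prop :=
  ∃ C : ℝ, ∀ n : ℤ, ‖u n‖ ≤ C * (1 + |(n : ℝ)| ^ C)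

/-- The denominator `q_n` of the `n`-th continued fraction approximant of `α`. -/
noncomputable def cfDen (α : ℝ) (n : ℕ) : ℝ := (GenContFract.of α).dens n

/-- The index `δ(α, θ) = limsup (ln ‖q_n (θ - 1/2)‖ + ln q_{n+1}) / q_n` in `[-∞, ∞]`, where
`‖·‖` is the distance to the nearest integer (the norm of `ℝ / ℤ`) and `ln 0 = -∞`. -/
noncomputable def marylandDelta (α θ : ℝ) : EReal :=
  Filter.limsup (fun n : ℕ =>
    (ENNReal.log (ENNReal.ofReal ‖((cfDen α n * (θ - 1 / 2) : ℝ) : UnitAddCircle)‖)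
        + ((Real.log (cfDen α (n + 1)) : ℝ) : EReal))
      / ((cfDen α n : ℝ) : EReal)) Filter.atTop

/-- The one-step transfer matrix of `h u = e u`. -/
noncomputable def transferMatrix (lam e x : ℝ) : Matrix (Fin 2) (Fin 2) ℝ :=
  !![e - lam * Real.tan (Real.pi * x), -1; 1, 0]

/-- The iterated cocycle `A_n(x) = A(x + (n-1) α) ⋯ A(x + α) A(x)`. -/
noncomputable def transferProduct (lam α e : ℝ) : ℕ → ℝ → Matrix (Fin 2) (Fin 2) ℝ
  | 0, _ => 1
  | n + 1, x => transferMatrix lam e (x + n * α) * transferProduct lam α e n x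

/-- The Lyapunov exponent `γ_lam(e) = lim (1/n) ∫_𝕋 ln ‖A_n(x)‖ dx`, with the Euclidean operator
norm of matrices. -/
noncomputable def lyapunovExponent (lam α e : ℝ) : ℝ :=
  Filter.limUnder Filter.atTop fun n : ℕ =>
    (1 / (n : ℝ)) * ∫ x in (0 : ℝ)..1,
      Real.log ‖Matrix.toEuclideanCLM (n := Fin 2) (𝕜 := ℝ) (transferProduct lam α e n x)‖

/-- The restriction of the operator with phase `x` to the sites `0, …, N - 1`, with Dirichlet
boundary conditions. -/
noncomputable def boxMatrix (lam α x : ℝ) (N : ℕ) : Matrix (Fin N) (Fin N) ℝ :=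
  Matrix.of fun i j =>
    if i = j then lam * Real.tan (Real.pi * (x + (i : ℕ) * α))
    else if (i : ℕ) = (j : ℕ) + 1 ∨ (j : ℕ) = (i : ℕ) + 1 then 1
    else 0

theorem boxMatrix_isHermitian (lam α x : ℝ) (N : ℕ) : (boxMatrix lam α x N).IsHermitian := by
  refine Matrix.IsHermitian.ext fun i j => ?_
  by_cases h : i = j
  · subst h; simp
  · simp [boxMatrix, h, Ne.symm h, or_comm]

/-- The number of eigenvalues at most `e`, with multiplicity, of the box restriction. -/
noncomputable def boxCount (lam α e x : ℝ) (N : ℕ) : ℕ :=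
  Nat.card {i : Fin N // (boxMatrix_isHermitian lam α x N).eigenvalues i ≤ e}

/-- The integrated density of states `k_lam(e)`: the limit, as the box grows, of the
phase-averaged number of eigenvalues at most `e` per site. -/
noncomputable def integratedDensityOfStates (lam α e : ℝ) : ℝ :=
  Filter.limUnder Filter.atTop fun N : ℕ =>
    (1 / (N : ℝ)) * ∫ x in (0 : ℝ)..1, (boxCount lam α e x N : ℝ)

/-! Write e(x) = exp(2πix). The proof has three ingredients.

Exact formulas. In z = e(x), the entry e - λ tan πx equals e + iλ(z-1)/(z+1), which is holomorphic
in |z| < 1 with negative imaginary part. At z = 0 the cocycle is a constant matrix with eigenvalues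
μ and 1/μ, where μ + 1/μ = e - iλ, |μ| > 1 and Im μ < 0. The Riccati iteration preserves the lower
half-plane, so the polynomials that arise have no zeros in the disc. Jensen's formula then gives
γ_λ(e) = ln|μ| (`lyapunovExponent_eq`). Sturm counting together with the mean value property of the
argument of the Riccati ratio gives k_λ(e) = 1 + arg μ/π (`integratedDensityOfStates_eq`). With b =
1/μ this says e(k_λ(e)) = b̄/b. Put c = e(arg μ/π - (θ - 1/2)); the claim becomes c = e(nα) for some
integer n.

A cocycle equation. Let S be the shift and T multiplication by e(nα), so that TS = e(α)ST. The
Cayley transform of the tangent turns hu = eu into Tv = c exp(Φ(S)) v, where v = (1 - b̄S)(1 -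
b̄S⁻¹)u and exp Φ(z) = (1-bz)(1-b/z) / ((1-b̄z)(1-b̄/z)). A polynomially bounded u lies in the
sup-norm space with weight R^|n| for every R > 1, and there the functional calculus of S converges
as soon as |b|R < 1. If φ(e(α)z) - φ(z) = Φ(z) has a solution analytic on the annulus, then
exp(-φ(S))v is a nonzero eigenvector of the diagonal operator T with eigenvalue c, which forces c =
e(nα) (`exists_eigenvector_of_cohomology`).

Small divisors. The solution has φ_k = Φ_k / (e(kα) - 1). For q_n < 2|k| ≤ q_{n+1} the divisor is
harmful only when q_n divides k, and then Φ_k carries a factor |(b̄/b)^{q_n} - 1|. Since b̄/b = c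
e(θ - 1/2), and the hypothesis on δ controls only e(q_n(θ - 1/2)), c^{q_n} must be controlled as
well. This comes from the solution u itself: in the q_n-fold iterate of the cocycle equation T^{q_n}
v is close to v and the exponential sums nearly vanish off multiples of q_n, so c^{q_n} is close to
1 up to a small multiple of |(b̄/b)^{q_n} - 1| (`exists_norm_pow_sub_one_le`). Absorbing that
multiple yields |(b̄/b)^{q_n} - 1| q_{n+1} = O(e^{γq_n}) for some γ < ln|μ|, and the decay |b|^{|k|}
wins (`summable_symbolCoeff_div`). -/

section
-- Law of inertia and Sturm counting for the box restrictions.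
open Matrix Finset

/-- If the quadratic form `e - H` is diagonalised by an injective linear change of variables, the
number of positive coefficients is the number of eigenvalues of `H` below `e` (law of inertia). -/
theorem card_eigenvalues_le_eq_card_pos {N : ℕ} {H : Matrix (Fin N) (Fin N) ℝ}
    (hH : H.IsHermitian) (e : ℝ) (m : Fin N → ℝ) (hm : ∀ i, m i ≠ 0)
    (L : (Fin N → ℝ) →ₗ[ℝ] (Fin N → ℝ)) (hL : Function.Injective L)
    (hform : ∀ y : Fin N → ℝ, e * (y ⬝ᵥ y) - y ⬝ᵥ (H *ᵥ y) = ∑ i, m i * (L y i) ^ 2) :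
    Nat.card {i : Fin N // hH.eigenvalues i ≤ e} = Nat.card {i : Fin N // 0 < m i} := by
  classical
  set B := hH.eigenvectorBasis with hB
  let E : EuclideanSpace ℝ (Fin N) ≃ₗ[ℝ] (Fin N → ℝ) := WithLp.linearEquiv 2 ℝ (Fin N → ℝ)
  -- the form in the eigenbasis
  have key : ∀ y : EuclideanSpace ℝ (Fin N),
      ∑ i, (e - hH.eigenvalues i) * (B.repr y i) ^ 2 = ∑ i, m i * (L (E y) i) ^ 2 := by
    intro y
    rw [← hform]
    have h1 : E y ⬝ᵥ E y = ∑ i, (B.repr y i) ^ 2 := by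
      have := B.repr.norm_map y
      have h2 : ‖B.repr y‖ ^ 2 = ‖y‖ ^ 2 := by rw [this]
      rw [EuclideanSpace.norm_sq_eq, EuclideanSpace.norm_sq_eq] at h2
      simp only [Real.norm_eq_abs, sq_abs] at h2
      rw [h2]
      simp [dotProduct, E, sq]
    have h3 : ∀ i, B.repr (WithLp.toLp 2 (H *ᵥ E y)) i = hH.eigenvalues i * B.repr y i := by
      intro i
      rw [B.repr_apply_apply, B.repr_apply_apply]
      have h4 := hH.mulVec_eigenvectorBasis i
      rw [EuclideanSpace.inner_eq_star_dotProduct, EuclideanSpace.inner_eq_star_dotProduct]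
      simp only [star_trivial]
      have h5 : (H *ᵥ E y) ⬝ᵥ (B i : Fin N → ℝ) = E y ⬝ᵥ (H *ᵥ (B i : Fin N → ℝ)) := by
        have hT : Hᵀ = H := by
          have := hH.eq; rwa [conjTranspose_eq_transpose_of_trivial] at this
        rw [dotProduct_mulVec, ← mulVec_transpose, hT]
      rw [h5, h4, dotProduct_smul]
      rfl
    have h6 : E y ⬝ᵥ (H *ᵥ E y) = ∑ i, hH.eigenvalues i * (B.repr y i) ^ 2 := by
      have h7 : inner ℝ (B.repr (WithLp.toLp 2 (H *ᵥ E y))) (B.repr y) =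
        inner ℝ (WithLp.toLp 2 (H *ᵥ E y)) y := B.repr.inner_map_map _ _
      rw [EuclideanSpace.inner_eq_star_dotProduct, EuclideanSpace.inner_eq_star_dotProduct] at h7
      simp only [star_trivial] at h7
      have : E y ⬝ᵥ (H *ᵥ E y) = y.ofLp ⬝ᵥ (H *ᵥ E y) := rfl
      rw [this, ← h7]
      simp only [dotProduct]
      refine Finset.sum_congr rfl fun i _ => ?_
      rw [h3]; ring
    rw [h1, h6, Finset.mul_sum, ← Finset.sum_sub_distrib]
    exact Finset.sum_congr rfl fun i _ => by ring
  -- dimension counts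
  have dim : ∀ p q : Fin N → Prop,
      (∀ y : EuclideanSpace ℝ (Fin N), (∀ i, p i → B.repr y i = 0) →
        (∀ i, q i → L (E y) i = 0) → y = 0) →
      N ≤ Nat.card {i // p i} + Nat.card {i // q i} := by
    intro p q h
    let F : EuclideanSpace ℝ (Fin N) →ₗ[ℝ] ({i // p i} → ℝ) × ({i // q i} → ℝ) :=
      LinearMap.prod
        (LinearMap.pi fun i => (LinearMap.proj (i : Fin N)) ∘ₗ
          (WithLp.linearEquiv 2 ℝ (Fin N → ℝ)).toLinearMap ∘ₗ B.repr.toLinearEquiv.toLinearMap)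
        (LinearMap.pi fun i => (LinearMap.proj (i : Fin N)) ∘ₗ L ∘ₗ E.toLinearMap)
    have hF : Function.Injective F := by
      rw [← LinearMap.ker_eq_bot, LinearMap.ker_eq_bot']
      intro y hy
      have hy1 := congrArg Prod.fst hy
      have hy2 := congrArg Prod.snd hy
      exact h y (fun i hi => congrFun hy1 ⟨i, hi⟩) (fun i hi => congrFun hy2 ⟨i, hi⟩)
    have := LinearMap.finrank_le_finrank_of_injective hF
    simpa [Nat.card_eq_fintype_card] using this
  have zero_of : ∀ y : EuclideanSpace ℝ (Fin N), L (E y) = 0 → y = 0 := by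
    intro y hy
    have : E y = 0 := hL (by rw [hy, map_zero])
    simpa using this
  -- On this subspace the form is nonnegative in the eigenbasis and nonpositive in the coordinates
  -- `L`, hence zero; since no `m i` vanishes, `L (E y) = 0`. The count gives #{eigenvalues ≤ e} ≤
  -- #{m > 0}.
  have d1 := dim (fun i => ¬ hH.eigenvalues i ≤ e) (fun i => 0 < m i) (by
    intro y h1 h2
    apply zero_of
    have hk := key y
    have hl : 0 ≤ ∑ i, (e - hH.eigenvalues i) * (B.repr y i) ^ 2 := by
      refine Finset.sum_nonneg fun i _ => ?_
      by_cases hi : hH.eigenvalues i ≤ e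
      · exact mul_nonneg (by linarith) (sq_nonneg _)
      · simp [h1 i hi]
    have hterm : ∀ i ∈ Finset.univ, m i * (L (E y) i) ^ 2 ≤ 0 := by
      intro i _
      by_cases hi : 0 < m i
      · simp [h2 i hi]
      · exact mul_nonpos_of_nonpos_of_nonneg (not_lt.mp hi) (sq_nonneg _)
    have hz : ∑ i, m i * (L (E y) i) ^ 2 = 0 := le_antisymm (Finset.sum_nonpos hterm) (hk ▸ hl)
    rw [Finset.sum_eq_zero_iff_of_nonpos hterm] at hz
    ext i
    simpa [hm i] using hz i (Finset.mem_univ i))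
  -- The reverse inequality. The coefficients that survive are e minus an eigenvalue above e, hence
  -- strictly negative; an eigenvalue equal to e falls under the constraint and does no harm.
  have d2 := dim (fun i => hH.eigenvalues i ≤ e) (fun i => ¬ 0 < m i) (by
    intro y h1 h2
    have hk := key y
    have hr : 0 ≤ ∑ i, m i * (L (E y) i) ^ 2 := by
      refine Finset.sum_nonneg fun i _ => ?_
      by_cases hi : 0 < m i
      · exact mul_nonneg hi.le (sq_nonneg _)
      · simp [h2 i hi]
    have hterm : ∀ i ∈ Finset.univ, (e - hH.eigenvalues i) * (B.repr y i) ^ 2 ≤ 0 := by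
      intro i _
      by_cases hi : hH.eigenvalues i ≤ e
      · simp [h1 i hi]
      · exact mul_nonpos_of_nonpos_of_nonneg (by linarith) (sq_nonneg _)
    have hz := le_antisymm (Finset.sum_nonpos hterm) (hk ▸ hr)
    rw [Finset.sum_eq_zero_iff_of_nonpos hterm] at hz
    apply B.repr.injective
    rw [map_zero]
    ext i
    by_cases hi : hH.eigenvalues i ≤ e
    · exact h1 i hi
    · have := hz i (Finset.mem_univ i)
      have h0 : e - hH.eigenvalues i ≠ 0 := by intro h0; exact hi (by linarith)
      simpa [h0] using this)
  have c1 : Nat.card {i : Fin N // hH.eigenvalues i ≤ e}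
      + Nat.card {i : Fin N // ¬ hH.eigenvalues i ≤ e} = N := by
    simp only [Nat.card_eq_fintype_card, Fintype.card_subtype_compl, Fintype.card_fin]
    have := Fintype.card_subtype_le (fun i : Fin N => hH.eigenvalues i ≤ e)
    rw [Fintype.card_fin] at this; omega
  have c2 : Nat.card {i : Fin N // 0 < m i} + Nat.card {i : Fin N // ¬ 0 < m i} = N := by
    simp only [Nat.card_eq_fintype_card, Fintype.card_subtype_compl, Fintype.card_fin]
    have := Fintype.card_subtype_le (fun i : Fin N => 0 < m i)
    rw [Fintype.card_fin] at this; omega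
  omega

/-- Extension by zero of a vector indexed by `Fin N`. -/
def zeroExtend {N : ℕ} (y : Fin N → ℝ) (n : ℕ) : ℝ := if h : n < N then y ⟨n, h⟩ else 0

theorem zeroExtend_val {N : ℕ} (y : Fin N → ℝ) (i : Fin N) : zeroExtend y i = y i := by
  simp [zeroExtend]

theorem sum_ite_eq_zeroExtend {N : ℕ} (y : Fin N → ℝ) (n : ℕ) :
    ∑ j : Fin N, (if (j : ℕ) = n then y j else 0) = zeroExtend y n := by
  unfold zeroExtend
  split_ifs with h
  · rw [Finset.sum_eq_single ⟨n, h⟩]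
    · simp
    · intro b _ hb
      rw [if_neg]
      intro h'
      exact hb (Fin.ext h')
    · simp
  · refine Finset.sum_eq_zero fun j _ => if_neg ?_
    intro h'
    exact h (h' ▸ j.2)

/-- Extending by zero encodes the Dirichlet condition: the bond from N - 1 to N appears in the sum
but contributes nothing. -/
theorem boxMatrix_form (lam α x : ℝ) (N : ℕ) (y : Fin N → ℝ) :
    y ⬝ᵥ (boxMatrix lam α x N *ᵥ y) =
      ∑ i ∈ Finset.range N, (lam * Real.tan (Real.pi * (x + i * α)) * zeroExtend y i ^ 2
        + 2 * (zeroExtend y i * zeroExtend y (i + 1))) := by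
  have hent : ∀ i j : Fin N, boxMatrix lam α x N i j =
      (if j = i then lam * Real.tan (Real.pi * (x + (i : ℕ) * α)) else 0)
        + (if (i : ℕ) = j + 1 then 1 else 0) + (if (j : ℕ) = i + 1 then 1 else 0) := by
    intro i j
    simp only [boxMatrix, Matrix.of_apply]
    by_cases h : i = j
    · subst h; simp
    · have h' : ¬ j = i := fun q => h q.symm
      by_cases h1 : (i : ℕ) = j + 1
      · have : ¬ (j : ℕ) = i + 1 := by omega
        rw [if_neg h, if_pos (Or.inl h1), if_neg h', if_pos h1, if_neg this]; norm_num
      · simp [h, h', h1]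
  have hexp : y ⬝ᵥ (boxMatrix lam α x N *ᵥ y) =
      (∑ i : Fin N, lam * Real.tan (Real.pi * (x + (i : ℕ) * α)) * y i ^ 2)
        + (∑ i : Fin N, ∑ j : Fin N, y i * ((if (i : ℕ) = j + 1 then y j else 0)))
        + ∑ i : Fin N, ∑ j : Fin N, y i * ((if (j : ℕ) = i + 1 then y j else 0)) := by
    rw [← Finset.sum_add_distrib, ← Finset.sum_add_distrib]
    simp only [dotProduct, mulVec]
    refine Finset.sum_congr rfl fun i _ => ?_
    rw [Finset.mul_sum]
    have : ∀ j, y i * (boxMatrix lam α x N i j * y j) =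
        (if j = i then y i * (lam * Real.tan (Real.pi * (x + (i : ℕ) * α)) * y j) else 0)
        + y i * ((if (i : ℕ) = j + 1 then y j else 0))
        + y i * ((if (j : ℕ) = i + 1 then y j else 0)) := by
      intro j
      rw [hent]
      split_ifs <;> ring
    simp only [this, Finset.sum_add_distrib]
    simp only [Finset.sum_ite_eq', Finset.mem_univ, if_true]
    ring
  have h2 : ∑ i : Fin N, ∑ j : Fin N, y i * ((if (j : ℕ) = i + 1 then y j else 0))
      = ∑ i ∈ Finset.range N, zeroExtend y i * zeroExtend y (i + 1) := by
    rw [Finset.sum_range]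
    refine Finset.sum_congr rfl fun i _ => ?_
    rw [← Finset.mul_sum, sum_ite_eq_zeroExtend, zeroExtend_val]
  have h3 : ∑ i : Fin N, ∑ j : Fin N, y i * ((if (i : ℕ) = j + 1 then y j else 0))
      = ∑ i ∈ Finset.range N, zeroExtend y i * zeroExtend y (i + 1) := by
    rw [← h2, Finset.sum_comm]
    refine Finset.sum_congr rfl fun i _ => Finset.sum_congr rfl fun j _ => ?_
    split_ifs <;> ring
  have h4 : ∑ i : Fin N, lam * Real.tan (Real.pi * (x + (i : ℕ) * α)) * y i ^ 2 =
      ∑ i ∈ Finset.range N, lam * Real.tan (Real.pi * (x + i * α)) * zeroExtend y i ^ 2 := by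
    rw [Finset.sum_range]
    simp only [zeroExtend_val]
  rw [hexp, h2, h3, h4, Finset.sum_add_distrib, ← Finset.mul_sum]
  ring

/-- Sturm counting: the number of eigenvalues at most `e` of the box restriction is the number of
positive ratios in the Riccati recursion. -/
theorem boxCount_eq_card_pos (lam α e x : ℝ) (N : ℕ) (m r : ℕ → ℝ) (hr0 : r 0 = 0)
    (hr : ∀ n < N, r (n + 1) = 1 / m n)
    (hmr : ∀ n < N, m n = e - lam * Real.tan (Real.pi * (x + n * α)) - r n)
    (hm : ∀ n < N, m n ≠ 0) :
    boxCount lam α e x N = Nat.card {i : Fin N // 0 < m i} := by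
  -- Completing the square site by site from the left: this is the unipotent bidiagonal factor of e
  -- - H, with pivots `m i`.
  let L : (Fin N → ℝ) →ₗ[ℝ] (Fin N → ℝ) :=
    { toFun := fun y i => y i - zeroExtend y (i + 1) / m i
      map_add' := by
        intro y z
        funext i
        simp only [Pi.add_apply, zeroExtend]
        split_ifs <;> ring
      map_smul' := by
        intro c y
        funext i
        simp only [Pi.smul_apply, smul_eq_mul, RingHom.id_apply, zeroExtend]
        split_ifs <;> ring }
  have hLapp : ∀ y i, L y i = y i - zeroExtend y (i + 1) / m i := fun _ _ => rfl
  refine card_eigenvalues_le_eq_card_pos _ e (fun i : Fin N => m i) (fun i => hm i i.2) L ?_ ?_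
  · rw [← LinearMap.ker_eq_bot, LinearMap.ker_eq_bot']
    intro y hy
    -- Back substitution, starting from the zero value at site N.
    have h : ∀ k ≤ N, zeroExtend y (N - k) = 0 := by
      intro k
      induction k with
      | zero => intro _; simp [zeroExtend]
      | succ k ih =>
        intro hk
        have h1 := ih (by omega)
        have h2 := congrFun hy ⟨N - (k + 1), by omega⟩
        rw [hLapp] at h2
        have h3 : N - (k + 1) + 1 = N - k := by omega
        simp only [h3, h1, zero_div, sub_zero, Pi.zero_apply] at h2
        rw [← zeroExtend_val y] at h2
        exact h2
    funext i
    have := h (N - i) (by omega)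
    rwa [show N - (N - (i : ℕ)) = i by omega, zeroExtend_val] at this
  · intro y
    rw [boxMatrix_form]
    have hyy : y ⬝ᵥ y = ∑ i ∈ Finset.range N, zeroExtend y i ^ 2 := by
      rw [Finset.sum_range]
      simp [dotProduct, zeroExtend_val, sq]
    have hsum : ∑ i : Fin N, m i * (L y i) ^ 2 =
        ∑ i ∈ Finset.range N, m i * (zeroExtend y i - zeroExtend y (i + 1) / m i) ^ 2 := by
      rw [Finset.sum_range]
      simp [hLapp, zeroExtend_val]
    -- The remainder `r n * y n ^ 2` is what completing the first n squares leaves at site n; at n =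
    -- N it vanishes by the boundary condition.
    have hind : ∀ n ≤ N,
        ∑ i ∈ Finset.range n, m i * (zeroExtend y i - zeroExtend y (i + 1) / m i) ^ 2 =
        ∑ i ∈ Finset.range n, ((e - lam * Real.tan (Real.pi * (x + i * α))) * zeroExtend y i ^ 2
          - 2 * (zeroExtend y i * zeroExtend y (i + 1))) + r n * zeroExtend y n ^ 2 := by
      intro n
      induction n with
      | zero => intro _; simp [hr0]
      | succ n ih =>
        intro hn
        rw [Finset.sum_range_succ, Finset.sum_range_succ, ih (by omega), hr n (by omega)]
        have h0 := hm n (by omega)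
        have h1 := hmr n (by omega)
        have h2 : e - lam * Real.tan (Real.pi * (x + n * α)) = m n + r n := by linarith
        have h3 : m n * (zeroExtend y n - zeroExtend y (n + 1) / m n) ^ 2 =
            m n * zeroExtend y n ^ 2 - 2 * (zeroExtend y n * zeroExtend y (n + 1))
              + 1 / m n * zeroExtend y (n + 1) ^ 2 := by
          field_simp
          ring
        rw [h2, h3, add_mul]
        generalize ∑ i ∈ Finset.range n, ((e - lam * Real.tan (Real.pi * (x + i * α)))
          * zeroExtend y i ^ 2 - 2 * (zeroExtend y i * zeroExtend y (i + 1))) = s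
        ring
    rw [hyy, hsum, hind N le_rfl, show zeroExtend y N = 0 by simp [zeroExtend], Finset.mul_sum,
      ← Finset.sum_sub_distrib]
    simp only [ne_eq, OfNat.ofNat_ne_zero, not_false_eq_true, zero_pow, mul_zero, add_zero]
    exact Finset.sum_congr rfl fun i _ => by ring
end

/-! ### The cocycle as polynomials in z, and the invariant lower half-plane. -/

section
open Polynomial in
/-- Numerator and denominator of the Riccati iteration of the Maryland cocycle, as polynomials in
`z = exp (2 π i x)`; `1 + ζ ^ n z` is the common denominator of the `n`-th transfer matrix. -/
noncomputable def cocyclePoly (lam e : ℝ) (ζ κ : ℂ) : ℕ → ℂ[X] × ℂ[X]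
  | 0 => (1, C κ)
  | n + 1 =>
    ((C (e : ℂ) * (1 + C (ζ ^ n) * X) + C (Complex.I * lam) * (C (ζ ^ n) * X - 1))
        * (cocyclePoly lam e ζ κ n).1 - (1 + C (ζ ^ n) * X) * (cocyclePoly lam e ζ κ n).2,
      (1 + C (ζ ^ n) * X) * (cocyclePoly lam e ζ κ n).1)

/-- Value of the numerator polynomial of the cocycle. -/
noncomputable def cocycleNum (lam e : ℝ) (ζ κ : ℂ) (n : ℕ) (z : ℂ) : ℂ :=
  (cocyclePoly lam e ζ κ n).1.eval z

/-- Value of the denominator polynomial of the cocycle. -/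
noncomputable def cocycleDen (lam e : ℝ) (ζ κ : ℂ) (n : ℕ) (z : ℂ) : ℂ :=
  (cocyclePoly lam e ζ κ n).2.eval z

section
variable (lam e : ℝ) (ζ κ : ℂ)

@[simp] theorem cocycleNum_zero (z : ℂ) : cocycleNum lam e ζ κ 0 z = 1 := by
  simp [cocycleNum, cocyclePoly]

@[simp] theorem cocycleDen_zero (z : ℂ) : cocycleDen lam e ζ κ 0 z = κ := by
  simp [cocycleDen, cocyclePoly]

theorem cocycleNum_succ (n : ℕ) (z : ℂ) : cocycleNum lam e ζ κ (n + 1) z =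
    (e * (1 + ζ ^ n * z) + Complex.I * lam * (ζ ^ n * z - 1)) * cocycleNum lam e ζ κ n z
      - (1 + ζ ^ n * z) * cocycleDen lam e ζ κ n z := by
  simp [cocycleNum, cocycleDen, cocyclePoly]

theorem cocycleDen_succ (n : ℕ) (z : ℂ) : cocycleDen lam e ζ κ (n + 1) z =
    (1 + ζ ^ n * z) * cocycleNum lam e ζ κ n z := by
  simp [cocycleNum, cocycleDen, cocyclePoly]

variable {lam ζ κ}

/-- Projectively this is m ↦ e + iλ(s-1)/(s+1) - 1/m with m = u/v. For |s| < 1 the first part has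
imaginary part λ(|s|²-1)/|1+s|² < 0, and m ↦ -1/m preserves the closed lower half-plane. The
homogeneous form also covers v = 0, that is m = ∞. -/
theorem im_riccati_neg (hlam : 0 < lam) {s u v : ℂ} (hs : ‖s‖ < 1) (hu : u ≠ 0)
    (h : (u * (starRingEnd ℂ) v).im ≤ 0) :
    (((e * (1 + s) + Complex.I * lam * (s - 1)) * u - (1 + s) * v)
      * (starRingEnd ℂ) ((1 + s) * u)).im < 0 := by
  have h1 : (((e * (1 + s) + Complex.I * lam * (s - 1)) * u - (1 + s) * v)
      * (starRingEnd ℂ) ((1 + s) * u)).im =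
      lam * (Complex.normSq s - 1) * Complex.normSq u
        + Complex.normSq (1 + s) * (u * (starRingEnd ℂ) v).im := by
    simp [Complex.normSq_apply]
    ring
  rw [h1]
  have h2 : Complex.normSq s < 1 := by
    rw [Complex.normSq_eq_norm_sq]
    exact pow_lt_one₀ (norm_nonneg _) hs two_ne_zero
  have h3 : 0 < Complex.normSq u := Complex.normSq_pos.mpr hu
  have h4 := Complex.normSq_nonneg (1 + s)
  have h5 : lam * (Complex.normSq s - 1) * Complex.normSq u < 0 :=
    mul_neg_of_neg_of_pos (mul_neg_of_pos_of_neg hlam (by linarith)) h3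
  have h6 := mul_nonpos_of_nonneg_of_nonpos h4 h
  linarith

theorem ne_zero_of_im_mul_conj_neg {u v : ℂ} (h : (u * (starRingEnd ℂ) v).im < 0) :
    u ≠ 0 ∧ v ≠ 0 := by
  constructor <;> rintro rfl <;> simp at h

/-- The starting slope 1/κ lies in the closed lower half-plane (or at infinity) when Im κ ≥ 0, and
each step preserves this. The value κ = i serves the norm of the cocycle, κ = 0 the Sturm ratios. -/
theorem cocycle_im_nonpos (hlam : 0 < lam) (hζ : ‖ζ‖ = 1) (hκ : 0 ≤ κ.im) {z : ℂ} (hz : ‖z‖ < 1)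
    (n : ℕ) : (cocycleNum lam e ζ κ n z * (starRingEnd ℂ) (cocycleDen lam e ζ κ n z)).im ≤ 0 ∧
      cocycleNum lam e ζ κ n z ≠ 0 := by
  induction n with
  | zero => simp [hκ]
  | succ n ih =>
    have := im_riccati_neg e hlam (s := ζ ^ n * z) (by simp [hζ, hz]) ih.2 ih.1
    rw [cocycleNum_succ, cocycleDen_succ]
    exact ⟨this.le, (ne_zero_of_im_mul_conj_neg this).1⟩

theorem cocycle_im_neg (hlam : 0 < lam) (hζ : ‖ζ‖ = 1) (hκ : 0 ≤ κ.im) {z : ℂ} (hz : ‖z‖ < 1)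
    (n : ℕ) : (cocycleNum lam e ζ κ (n + 1) z
      * (starRingEnd ℂ) (cocycleDen lam e ζ κ (n + 1) z)).im < 0 := by
  have ih := cocycle_im_nonpos e hlam hζ hκ hz n
  rw [cocycleNum_succ, cocycleDen_succ]
  exact im_riccati_neg e hlam (s := ζ ^ n * z) (by simp [hζ, hz]) ih.2 ih.1

end

/-- On the unit circle, `e - lam tan (π y)` is a Möbius function of `exp (2 π i y)`. -/
theorem sub_tan_mul_one_add_exp (lam e y : ℝ) (hy : Real.cos (Real.pi * y) ≠ 0) :
    ((e - lam * Real.tan (Real.pi * y) : ℝ) : ℂ) * (1 + Complex.exp (2 * Real.pi * Complex.I * y)) =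
      e * (1 + Complex.exp (2 * Real.pi * Complex.I * y))
        + Complex.I * lam * (Complex.exp (2 * Real.pi * Complex.I * y) - 1) := by
  have hexp : Complex.exp (2 * Real.pi * Complex.I * y) =
      (Complex.cos (Real.pi * y) + Complex.sin (Real.pi * y) * Complex.I) ^ 2 := by
    rw [← Complex.exp_mul_I, ← Complex.exp_nat_mul]
    congr 1; push_cast; ring
  have hc : Complex.cos (Real.pi * y) ≠ 0 := by
    rw [← Complex.ofReal_mul, ← Complex.ofReal_cos]
    exact_mod_cast hy
  rw [hexp]
  push_cast
  rw [Complex.tan_eq_sin_div_cos]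
  set c := Complex.cos (Real.pi * y)
  set s := Complex.sin (Real.pi * y)
  have hcs : s ^ 2 + c ^ 2 = 1 := Complex.sin_sq_add_cos_sq _
  have hI := Complex.I_sq
  have h1 : 1 + (c + s * Complex.I) ^ 2 = 2 * c * (c + s * Complex.I) := by
    linear_combination (s ^ 2) * hI - hcs
  have h2 : (c + s * Complex.I) ^ 2 - 1 = 2 * s * Complex.I * (c + s * Complex.I) := by
    linear_combination -(s ^ 2) * hI + hcs
  rw [h1, h2]
  field_simp
  linear_combination (-lam * s * (c + s * Complex.I)) * hI

theorem one_add_exp_ne_zero_iff (y : ℝ) :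
    1 + Complex.exp (2 * Real.pi * Complex.I * y) ≠ 0 ↔ Real.cos (Real.pi * y) ≠ 0 := by
  have hexp : Complex.exp (2 * Real.pi * Complex.I * y) =
      (Complex.cos (Real.pi * y) + Complex.sin (Real.pi * y) * Complex.I) ^ 2 := by
    rw [← Complex.exp_mul_I, ← Complex.exp_nat_mul]
    congr 1; push_cast; ring
  rw [hexp]
  have h0 : Complex.cos (Real.pi * y) + Complex.sin (Real.pi * y) * Complex.I ≠ 0 := by
    rw [← Complex.exp_mul_I]; exact Complex.exp_ne_zero _
  have hc : Complex.cos (Real.pi * y) = (Real.cos (Real.pi * y) : ℝ) := by push_cast; rfl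
  have hcs := Complex.sin_sq_add_cos_sq (Real.pi * y)
  have h1 : 1 + (Complex.cos (Real.pi * y) + Complex.sin (Real.pi * y) * Complex.I) ^ 2 =
      2 * Complex.cos (Real.pi * y)
        * (Complex.cos (Real.pi * y) + Complex.sin (Real.pi * y) * Complex.I) := by
    linear_combination (Complex.sin (Real.pi * y) ^ 2) * Complex.I_sq - hcs
  rw [h1, hc]
  simp only [ne_eq, mul_eq_zero, OfNat.ofNat_ne_zero, false_or, Complex.ofReal_eq_zero]
  rw [← hc]
  tauto

/-- The rotation number `exp (2 π i α)`. -/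
noncomputable def unitExp (x : ℝ) : ℂ := Complex.exp (2 * Real.pi * Complex.I * x)

theorem norm_unitExp (x : ℝ) : ‖unitExp x‖ = 1 := by
  rw [unitExp, show 2 * Real.pi * Complex.I * x = ((2 * Real.pi * x : ℝ) : ℂ) * Complex.I by
    push_cast; ring, Complex.norm_exp_ofReal_mul_I]

theorem unitExp_add (x y : ℝ) : unitExp (x + y) = unitExp x * unitExp y := by
  rw [unitExp, unitExp, unitExp, ← Complex.exp_add]; congr 1; push_cast; ring

theorem unitExp_natCast_mul (n : ℕ) (x : ℝ) : unitExp (n * x) = unitExp x ^ n := by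
  rw [unitExp, unitExp, ← Complex.exp_nat_mul]; congr 1; push_cast; ring

theorem unitExp_add_natCast_mul (x α : ℝ) (n : ℕ) :
    unitExp (x + n * α) = unitExp α ^ n * unitExp x := by
  rw [unitExp_add, unitExp_natCast_mul, mul_comm]

/-- Clearing the factors 1 + ζ^j z exhibits the real cocycle applied to (1, κ) as boundary values of
polynomials. The poles of the tangent are excluded because `Real.tan` takes the value 0 there. -/
theorem transferProduct_mul_prod (lam α e x : ℝ) (κ : ℂ) (n : ℕ)
    (h : ∀ j < n, 1 + unitExp α ^ j * unitExp x ≠ 0) :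
    ((transferProduct lam α e n x 0 0 : ℂ) + κ * transferProduct lam α e n x 0 1)
        * ∏ j ∈ Finset.range n, (1 + unitExp α ^ j * unitExp x)
        = cocycleNum lam e (unitExp α) κ n (unitExp x) ∧
    ((transferProduct lam α e n x 1 0 : ℂ) + κ * transferProduct lam α e n x 1 1)
        * ∏ j ∈ Finset.range n, (1 + unitExp α ^ j * unitExp x)
        = cocycleDen lam e (unitExp α) κ n (unitExp x) := by
  induction n with
  | zero => simp [transferProduct]
  | succ n ih =>
    obtain ⟨ih1, ih2⟩ := ih fun j hj => h j (by omega)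
    have hn := h n (by omega)
    have ht : ((e - lam * Real.tan (Real.pi * (x + n * α)) : ℝ) : ℂ)
        * (1 + unitExp α ^ n * unitExp x) = e * (1 + unitExp α ^ n * unitExp x)
        + Complex.I * lam * (unitExp α ^ n * unitExp x - 1) := by
      rw [← unitExp_add_natCast_mul] at hn ⊢
      exact sub_tan_mul_one_add_exp lam e _ ((one_add_exp_ne_zero_iff _).mp hn)
    rw [cocycleNum_succ, cocycleDen_succ, Finset.prod_range_succ, ← ht, ← ih1, ← ih2]
    simp only [transferProduct, transferMatrix, Matrix.mul_apply, Fin.sum_univ_two, Matrix.of_apply,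
      Matrix.cons_val', Matrix.cons_val_zero, Matrix.cons_val_one, Matrix.cons_val_fin_one]
    push_cast
    constructor <;> ring
end

/-! ### Jensen's formula and the integral of the logarithm of the cocycle norm. -/

section
open MeasureTheory Filter Topology
-- The Mahler measure is |leading coefficient| · ∏ max(1, |root|). With no root in the open disc
-- each maximum is |root|, and the product is |p(0)|.
open Polynomial in
theorem mahlerMeasure_eq_norm_eval_zero {p : ℂ[X]} (h : ∀ z : ℂ, ‖z‖ < 1 → p.eval z ≠ 0) :
    p.mahlerMeasure = ‖p.eval 0‖ := by
  have hp : p ≠ 0 := by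
    rintro rfl
    exact h 0 (by simp) (by simp)
  rw [mahlerMeasure_eq_leadingCoeff_mul_prod_roots]
  conv_rhs => rw [(IsAlgClosed.splits p).eq_prod_roots]
  rw [eval_mul, eval_C, norm_mul, eval_multiset_prod, Multiset.map_map]
  congr 1
  have hn : ∀ s : Multiset ℂ, ‖s.prod‖ = (s.map fun a => ‖a‖).prod := fun s =>
    map_multiset_prod (normHom : ℂ →*₀ ℝ) s
  rw [hn, Multiset.map_map]
  congr 1
  refine Multiset.map_congr rfl fun a ha => ?_
  have : 1 ≤ ‖a‖ := by
    by_contra hlt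
    exact h a (not_le.mp hlt) ((mem_roots hp).mp ha)
  simp [this]

theorem circleMap_eq_unitExp (x : ℝ) : circleMap 0 1 (2 * Real.pi * x) = unitExp x := by
  simp only [circleMap, unitExp, zero_add, Complex.ofReal_one, one_mul]
  congr 1; push_cast; ring

theorem circleAverage_eq_integral_unitExp (f : ℂ → ℝ) :
    Real.circleAverage f 0 1 = ∫ x in (0 : ℝ)..1, f (unitExp x) := by
  rw [Real.circleAverage_def]
  have := intervalIntegral.integral_comp_mul_left (a := 0) (b := 1)
    (fun t => f (circleMap 0 1 t)) (c := 2 * Real.pi) (by positivity)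
  simp only [circleMap_eq_unitExp, mul_zero, mul_one] at this
  rw [this]

theorem intervalIntegrable_unitExp {f : ℂ → ℝ}
    (h : IntervalIntegrable (fun t => f (circleMap 0 1 t)) volume 0 (2 * Real.pi)) :
    IntervalIntegrable (fun x => f (unitExp x)) volume 0 1 := by
  have := h.comp_mul_left (c := 2 * Real.pi)
  simpa [circleMap_eq_unitExp, Real.pi_ne_zero] using this

open Polynomial in
theorem integral_log_norm_eval_unitExp {p : ℂ[X]} (h : ∀ z : ℂ, ‖z‖ < 1 → p.eval z ≠ 0) :
    ∫ x in (0 : ℝ)..1, Real.log ‖p.eval (unitExp x)‖ = Real.log ‖p.eval 0‖ := by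
  rw [← mahlerMeasure_eq_norm_eval_zero h, ← logMahlerMeasure_eq_log_MahlerMeasure,
    logMahlerMeasure_def, circleAverage_eq_integral_unitExp fun z => Real.log ‖eval z p‖]

open Polynomial in
theorem intervalIntegrable_log_norm_eval_unitExp (p : ℂ[X]) :
    IntervalIntegrable (fun x => Real.log ‖p.eval (unitExp x)‖) volume 0 1 :=
  intervalIntegrable_unitExp (f := fun z => Real.log ‖p.eval z‖) p.intervalIntegrable_mahlerMeasure

theorem unitExp_eq_unitExp_iff (x y : ℝ) : unitExp x = unitExp y ↔ ∃ n : ℤ, x = y + n := by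
  have h2 : (2 * Real.pi * Complex.I) ≠ 0 := by simp [Real.pi_ne_zero]
  rw [unitExp, unitExp, Complex.exp_eq_exp_iff_exists_int]
  refine exists_congr fun n => ?_
  constructor
  · intro h
    have h3 : (2 * Real.pi * Complex.I) * (x : ℂ) = (2 * Real.pi * Complex.I) * ((y + n : ℝ) : ℂ) := by
      push_cast; linear_combination h
    exact_mod_cast mul_left_cancel₀ h2 h3
  · rintro rfl
    push_cast; ring

open Polynomial in
/-- A nonzero polynomial does not vanish at almost every point of the unit circle. -/
theorem ae_eval_unitExp_ne_zero {p : ℂ[X]} (hp : p ≠ 0) : ∀ᵐ x : ℝ, p.eval (unitExp x) ≠ 0 := by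
  rw [ae_iff]
  refine Set.Countable.measure_zero ?_ _
  have : {x : ℝ | ¬ p.eval (unitExp x) ≠ 0} = ⋃ r ∈ (p.roots.toFinset : Set ℂ), {x | unitExp x = r} := by
    ext x
    simp [hp]
  rw [this]
  refine Set.Countable.biUnion (Finset.countable_toSet _) fun r _ => ?_
  by_cases h : ∃ y, unitExp y = r
  · obtain ⟨y, rfl⟩ := h
    refine (Set.countable_range fun n : ℤ => y + (n : ℝ)).mono ?_
    rintro x hx
    obtain ⟨n, hn⟩ := (unitExp_eq_unitExp_iff x y).mp hx
    exact ⟨n, hn.symm⟩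
  · rw [Set.eq_empty_of_forall_notMem (s := {x | unitExp x = r}) fun x hx => h ⟨x, hx⟩]
    exact Set.countable_empty

theorem det_transferProduct (lam α e : ℝ) (n : ℕ) (x : ℝ) :
    (transferProduct lam α e n x).det = 1 := by
  induction n with
  | zero => simp [transferProduct]
  | succ n ih => rw [transferProduct, Matrix.det_mul, ih]; simp [transferMatrix, Matrix.det_fin_two]

/-- `|a + d + i (b - c)|`, comparable to the operator norm on `SL(2, ℝ)`. -/
noncomputable def conformalNorm (A : Matrix (Fin 2) (Fin 2) ℝ) : ℝ :=
  ‖((A 0 0 : ℂ) + Complex.I * A 0 1) - Complex.I * (A 1 0 + Complex.I * A 1 1)‖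

theorem conformalNorm_sq (A : Matrix (Fin 2) (Fin 2) ℝ) :
    conformalNorm A ^ 2 = (A 0 0 + A 1 1) ^ 2 + (A 0 1 - A 1 0) ^ 2 := by
  have : ((A 0 0 : ℂ) + Complex.I * A 0 1) - Complex.I * (A 1 0 + Complex.I * A 1 1) =
      ((A 0 0 + A 1 1 : ℝ) : ℂ) + ((A 0 1 - A 1 0 : ℝ) : ℂ) * Complex.I := by
    push_cast
    linear_combination (-(A 1 1 : ℂ)) * Complex.I_sq
  rw [conformalNorm, this, ← Complex.normSq_eq_norm_sq, Complex.normSq_add_mul_I]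

theorem conformalNorm_nonneg (A : Matrix (Fin 2) (Fin 2) ℝ) : 0 ≤ conformalNorm A := norm_nonneg _

/-- For determinant 1, (a+d)² + (b-c)² is the squared Hilbert–Schmidt norm plus 2, which dominates
the squared operator norm. -/
theorem opNorm_le_conformalNorm {A : Matrix (Fin 2) (Fin 2) ℝ} (hA : A.det = 1) :
    ‖Matrix.toEuclideanCLM (n := Fin 2) (𝕜 := ℝ) A‖ ≤ conformalNorm A := by
  refine ContinuousLinearMap.opNorm_le_bound _ (conformalNorm_nonneg A) fun v => ?_
  rw [Matrix.det_fin_two] at hA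
  refine abs_le_of_sq_le_sq' ?_ (mul_nonneg (conformalNorm_nonneg A) (norm_nonneg v)) |>.2
  rw [mul_pow, conformalNorm_sq, EuclideanSpace.norm_sq_eq, EuclideanSpace.norm_sq_eq]
  simp only [Fin.sum_univ_two, Real.norm_eq_abs, sq_abs]
  have h0 : ∀ i, (Matrix.toEuclideanCLM (n := Fin 2) (𝕜 := ℝ) A v) i = A i 0 * v 0 + A i 1 * v 1 := by
    intro i
    simp [Matrix.ofLp_toEuclideanCLM, Matrix.mulVec, dotProduct, Fin.sum_univ_two]
  rw [h0, h0]
  nlinarith [sq_nonneg (A 0 0 * v 1 - A 0 1 * v 0), sq_nonneg (A 1 0 * v 1 - A 1 1 * v 0),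
    sq_nonneg (v 0), sq_nonneg (v 1)]

theorem conformalNorm_le_four_mul_opNorm (A : Matrix (Fin 2) (Fin 2) ℝ) :
    conformalNorm A ≤ 4 * ‖Matrix.toEuclideanCLM (n := Fin 2) (𝕜 := ℝ) A‖ := by
  have hent : ∀ i j, |A i j| ≤ ‖Matrix.toEuclideanCLM (n := Fin 2) (𝕜 := ℝ) A‖ := by
    intro i j
    have h1 := (Matrix.toEuclideanCLM (n := Fin 2) (𝕜 := ℝ) A).le_opNorm (EuclideanSpace.single j 1)
    rw [show ‖EuclideanSpace.single j (1 : ℝ)‖ = 1 by simp, mul_one] at h1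
    refine le_trans ?_ h1
    have h2 := PiLp.norm_apply_le (Matrix.toEuclideanCLM (n := Fin 2) (𝕜 := ℝ) A
      (EuclideanSpace.single j 1)) i
    simpa [Matrix.ofLp_toEuclideanCLM] using h2
  have h := norm_sub_le ((A 0 0 : ℂ) + Complex.I * A 0 1) (Complex.I * (A 1 0 + Complex.I * A 1 1))
  have h1 := norm_add_le (A 0 0 : ℂ) (Complex.I * A 0 1)
  have h2 := norm_add_le (A 1 0 : ℂ) (Complex.I * A 1 1)
  simp only [norm_mul, Complex.norm_I, one_mul, Complex.norm_real, Real.norm_eq_abs] at h h1 h2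
  have := hent 0 0; have := hent 0 1; have := hent 1 0; have := hent 1 1
  unfold conformalNorm
  linarith

theorem measurable_transferProduct (lam α e : ℝ) (n : ℕ) (i j : Fin 2) :
    Measurable fun x => transferProduct lam α e n x i j := by
  have hT : ∀ i j, Measurable fun x => transferMatrix lam e x i j := by
    intro i j
    have htan : Measurable fun x : ℝ => e - lam * Real.tan (Real.pi * x) := by
      simp only [Real.tan_eq_sin_div_cos]
      fun_prop
    fin_cases i <;> fin_cases j <;> simp [transferMatrix]
    exact htan
  induction n generalizing i j with
  | zero => simp only [transferProduct]; exact measurable_const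
  | succ n ih =>
    simp only [transferProduct, Matrix.mul_apply]
    refine Finset.measurable_sum _ fun k _ => ?_
    have h1 : Measurable fun x => transferMatrix lam e (x + n * α) i k :=
      (hT i k).comp (by fun_prop)
    exact h1.mul (ih k j)

/-- `∫ ln ‖A_n‖` is known up to a bounded error. -/
theorem abs_integral_log_norm_transferProduct_sub_le (lam α e : ℝ) (hlam : 0 < lam) (n : ℕ) :
    |(∫ x in (0 : ℝ)..1,
      Real.log ‖Matrix.toEuclideanCLM (n := Fin 2) (𝕜 := ℝ) (transferProduct lam α e n x)‖)
      - Real.log ‖cocycleNum lam e (unitExp α) Complex.I n 0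
          - Complex.I * cocycleDen lam e (unitExp α) Complex.I n 0‖| ≤ Real.log 4 := by
  set ζ := unitExp α
  have hζ : ‖ζ‖ = 1 := norm_unitExp α
  let W : Polynomial ℂ := ∏ j ∈ Finset.range n, (1 + Polynomial.C (ζ ^ j) * Polynomial.X)
  -- The entries enter `conformalNorm` through the image of (1, i), so `conformalNorm` times |W| is
  -- |p| on the circle: unlike the operator norm, it is the modulus of a holomorphic function.
  let p : Polynomial ℂ := (cocyclePoly lam e ζ Complex.I n).1
    - Polynomial.C Complex.I * (cocyclePoly lam e ζ Complex.I n).2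
  have hWe : ∀ z, W.eval z = ∏ j ∈ Finset.range n, (1 + ζ ^ j * z) := by
    intro z; simp [W, Polynomial.eval_prod]
  have hpe : ∀ z, p.eval z = cocycleNum lam e ζ Complex.I n z
      - Complex.I * cocycleDen lam e ζ Complex.I n z := by
    intro z; simp [p, cocycleNum, cocycleDen]
  have hW : ∀ z : ℂ, ‖z‖ < 1 → W.eval z ≠ 0 := by
    intro z hz
    rw [hWe, Finset.prod_ne_zero_iff]
    intro j _ h0
    have : ζ ^ j * z = -1 := by linear_combination h0
    have h1 := congrArg norm this
    rw [norm_mul, norm_pow, hζ, one_pow, one_mul, norm_neg, norm_one] at h1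
    linarith
  -- A zero would mean u = iv, so Im(u v̄) = |v|² ≥ 0; the half-plane bound then forces v = 0 and u
  -- = 0, which is excluded.
  have hp : ∀ z : ℂ, ‖z‖ < 1 → p.eval z ≠ 0 := by
    intro z hz
    rw [hpe]
    intro h0
    have h1 := cocycle_im_nonpos e hlam hζ (κ := Complex.I) (by simp) hz n
    have h2 : cocycleNum lam e ζ Complex.I n z = Complex.I * cocycleDen lam e ζ Complex.I n z := by
      linear_combination h0
    rw [h2, mul_assoc, Complex.mul_conj] at h1
    have h3 : (Complex.normSq (cocycleDen lam e ζ Complex.I n z)) ≤ 0 := by simpa using h1.1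
    have h4 : cocycleDen lam e ζ Complex.I n z = 0 :=
      Complex.normSq_eq_zero.mp (le_antisymm h3 (Complex.normSq_nonneg _))
    exact h1.2 (by rw [h4]; simp)
  have hW0 : W ≠ 0 := by rintro h; exact hW 0 (by simp) (by simp [h])
  have hp0 : p ≠ 0 := by rintro h; exact hp 0 (by simp) (by simp [h])
  let F : ℝ → ℝ := fun x => Real.log ‖p.eval (unitExp x)‖ - Real.log ‖W.eval (unitExp x)‖
  have hFint : IntervalIntegrable F volume 0 1 :=
    (intervalIntegrable_log_norm_eval_unitExp p).sub (intervalIntegrable_log_norm_eval_unitExp W)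
  -- The denominator contributes nothing, as W(0) = 1.
  have hF : ∫ x in (0 : ℝ)..1, F x = Real.log ‖p.eval 0‖ := by
    rw [intervalIntegral.integral_sub (intervalIntegrable_log_norm_eval_unitExp p)
      (intervalIntegrable_log_norm_eval_unitExp W), integral_log_norm_eval_unitExp hp,
      integral_log_norm_eval_unitExp hW, hWe]
    simp
  let G : ℝ → ℝ := fun x =>
    Real.log ‖Matrix.toEuclideanCLM (n := Fin 2) (𝕜 := ℝ) (transferProduct lam α e n x)‖
  have hFG : ∀ᵐ x : ℝ, |G x - F x| ≤ Real.log 4 := by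
    filter_upwards [ae_eval_unitExp_ne_zero hW0, ae_eval_unitExp_ne_zero hp0] with x hx1 hx2
    have hxj : ∀ j < n, 1 + ζ ^ j * unitExp x ≠ 0 := by
      intro j hj
      rw [hWe, Finset.prod_ne_zero_iff] at hx1
      exact hx1 j (Finset.mem_range.mpr hj)
    obtain ⟨h1, h2⟩ := transferProduct_mul_prod lam α e x Complex.I n hxj
    have hcn : conformalNorm (transferProduct lam α e n x) * ‖W.eval (unitExp x)‖
        = ‖p.eval (unitExp x)‖ := by
      rw [conformalNorm, ← norm_mul, hpe, ← h1, ← h2, hWe]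
      congr 1; ring
    have hWpos : 0 < ‖W.eval (unitExp x)‖ := norm_pos_iff.mpr hx1
    have hppos : 0 < ‖p.eval (unitExp x)‖ := norm_pos_iff.mpr hx2
    have hcpos : 0 < conformalNorm (transferProduct lam α e n x) := by
      by_contra hneg
      have := mul_nonpos_of_nonpos_of_nonneg (not_lt.mp hneg) hWpos.le
      linarith
    have hFx : F x = Real.log (conformalNorm (transferProduct lam α e n x)) := by
      simp only [F]
      rw [← hcn, Real.log_mul hcpos.ne' hWpos.ne']; ring
    have hle := opNorm_le_conformalNorm (det_transferProduct lam α e n x)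
    have hge := conformalNorm_le_four_mul_opNorm (transferProduct lam α e n x)
    have hopos : 0 < ‖Matrix.toEuclideanCLM (n := Fin 2) (𝕜 := ℝ) (transferProduct lam α e n x)‖ := by
      linarith
    have l1 := Real.log_le_log hopos hle
    have l2 := Real.log_le_log hcpos hge
    rw [Real.log_mul (by norm_num) hopos.ne'] at l2
    have l3 : 0 ≤ Real.log 4 := Real.log_nonneg (by norm_num)
    rw [hFx, abs_le]
    constructor <;> simp only [G] <;> linarith
  have hGmeas : Measurable G := by
    let T : (Fin 2 → Fin 2 → ℝ) →ₗ[ℝ] (EuclideanSpace ℝ (Fin 2) →L[ℝ] EuclideanSpace ℝ (Fin 2)) :=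
      { toFun := fun f => Matrix.toEuclideanCLM (n := Fin 2) (𝕜 := ℝ) (Matrix.of f)
        map_add' := fun f g => map_add (Matrix.toEuclideanCLM (n := Fin 2) (𝕜 := ℝ)) _ _
        map_smul' := fun c f => map_smul (Matrix.toEuclideanCLM (n := Fin 2) (𝕜 := ℝ)) c _ }
    have hc : Continuous fun f => ‖T f‖ :=
      continuous_norm.comp (LinearMap.continuous_of_finiteDimensional T)
    have hm : Measurable fun x => (fun i j => transferProduct lam α e n x i j) :=
      measurable_pi_lambda _ fun i => measurable_pi_lambda _ fun j =>
        measurable_transferProduct lam α e n i j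
    exact Real.measurable_log.comp (hc.measurable.comp hm)
  have hGF : IntervalIntegrable (fun x => G x - F x) volume 0 1 := by
    refine (intervalIntegrable_const (c := Real.log 4)).mono_fun ?_ ?_
    · rw [Set.uIoc_of_le zero_le_one]
      exact (hGmeas.aestronglyMeasurable).sub (hFint.aestronglyMeasurable)
    · refine ae_restrict_of_ae ?_
      filter_upwards [hFG] with x hx
      rw [Real.norm_eq_abs, Real.norm_eq_abs]
      exact hx.trans (le_abs_self _)
  have hGint : IntervalIntegrable G volume 0 1 := by
    have := hGF.add hFint
    simpa using this
  rw [← hpe, ← hF]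
  change |(∫ x in (0 : ℝ)..1, G x) - _| ≤ _
  rw [← intervalIntegral.integral_sub hGint hFint]
  have := intervalIntegral.norm_integral_le_of_norm_le_const_ae (a := (0 : ℝ)) (b := 1)
    (f := fun x => G x - F x) (C := Real.log 4) (by
      filter_upwards [hFG] with x hx _
      simpa using hx)
  simpa using this
end

/-! ### Lyapunov exponent and density of states in terms of μ. -/

section
open MeasureTheory Filter Topology

/-- The roots of μ² - cμ + 1, with c = e - iλ, have product 1. Neither lies on the unit circle,
since then c = μ + μ̄ would be real. For the larger one, Im c = Im μ · (1 - 1/|μ|²) gives Im μ the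
sign of -λ. -/
theorem exists_dominant_eigenvalue (lam e : ℝ) (hlam : 0 < lam) :
    ∃ μ : ℂ, 1 < ‖μ‖ ∧ μ.im < 0 ∧ μ + μ⁻¹ = e - Complex.I * lam := by
  obtain ⟨s, hs⟩ := IsAlgClosed.exists_pow_nat_eq
    (((e : ℂ) - Complex.I * lam) ^ 2 - 4) (n := 2) (by norm_num)
  set c : ℂ := (e : ℂ) - Complex.I * lam with hc
  have hprod : ((c + s) / 2) * ((c - s) / 2) = 1 := by linear_combination (-1 / 4) * hs
  have hcim : c.im = -lam := by simp [hc]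
  have main : ∀ μ ν : ℂ, μ * ν = 1 → μ + ν = c → 1 < ‖μ‖ →
      ∃ μ : ℂ, 1 < ‖μ‖ ∧ μ.im < 0 ∧ μ + μ⁻¹ = c := by
    intro μ ν h1 h2 h3
    have hν : μ⁻¹ = ν := inv_eq_of_mul_eq_one_right h1
    refine ⟨μ, h3, ?_, by rw [hν, h2]⟩
    have h4 : c.im = μ.im * (1 - 1 / Complex.normSq μ) := by
      rw [← h2, ← hν, Complex.add_im, Complex.inv_im]; ring
    have h5 : 1 < Complex.normSq μ := by
      rw [Complex.normSq_eq_norm_sq]; nlinarith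
    have h6 : 0 < 1 - 1 / Complex.normSq μ := by
      rw [sub_pos, div_lt_one (by linarith)]; exact h5
    by_contra hneg
    have := mul_nonneg (not_lt.mp hneg) h6.le
    linarith
  rcases lt_trichotomy 1 ‖(c + s) / 2‖ with h | h | h
  · exact main _ _ hprod (by ring) h
  · exfalso
    have hμ : ((c + s) / 2) * (starRingEnd ℂ) ((c + s) / 2) = 1 := by
      rw [Complex.mul_conj, Complex.normSq_eq_norm_sq, ← h]; simp
    have h0 : (c + s) / 2 ≠ 0 := by
      intro h0; rw [h0, norm_zero] at h; norm_num at h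
    have h1 : (c - s) / 2 = (starRingEnd ℂ) ((c + s) / 2) :=
      mul_left_cancel₀ h0 (hprod.trans hμ.symm)
    have h2 : c = (c + s) / 2 + (starRingEnd ℂ) ((c + s) / 2) := by rw [← h1]; ring
    have h3 := congrArg Complex.im h2
    rw [Complex.add_im, Complex.conj_im] at h3
    linarith
  · refine main ((c - s) / 2) ((c + s) / 2) (by rw [mul_comm, hprod]) (by ring) ?_
    have h1 := congrArg norm hprod
    rw [norm_mul, norm_one] at h1
    by_contra hle
    have := mul_lt_one_of_nonneg_of_lt_one_left (norm_nonneg _) h (not_lt.mp hle)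
    linarith

section
variable {lam e : ℝ} {μ : ℂ}

theorem one_lt_norm_sub_inv_ne_zero (h : 1 < ‖μ‖) : μ ≠ 0 ∧ μ - μ⁻¹ ≠ 0 := by
  have h0 : μ ≠ 0 := by rintro rfl; simp at h; linarith
  refine ⟨h0, fun h1 => ?_⟩
  have h2 : μ = μ⁻¹ := sub_eq_zero.mp h1
  have h3 := congrArg norm h2
  rw [norm_inv] at h3
  have := inv_lt_one_of_one_lt₀ h
  linarith

/-- At the centre of the disc the cocycle is constant, with eigenvalues `μ` and `μ⁻¹`. -/
theorem cocycle_at_zero (h : 1 < ‖μ‖) (hμ : μ + μ⁻¹ = e - Complex.I * lam) (ζ κ : ℂ) (n : ℕ) :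
    (μ - μ⁻¹) * cocycleNum lam e ζ κ n 0 = (1 - κ * μ⁻¹) * μ ^ (n + 1) + (κ * μ - 1) * μ⁻¹ ^ (n + 1)
    ∧ (μ - μ⁻¹) * cocycleDen lam e ζ κ n 0 = (1 - κ * μ⁻¹) * μ ^ n + (κ * μ - 1) * μ⁻¹ ^ n := by
  have h1 : μ * μ⁻¹ = 1 := mul_inv_cancel₀ (one_lt_norm_sub_inv_ne_zero h).1
  induction n with
  | zero => constructor <;> simp <;> ring
  | succ n ih =>
    obtain ⟨ih1, ih2⟩ := ih
    rw [cocycleNum_succ, cocycleDen_succ]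
    simp only [mul_zero, add_zero, mul_one, zero_sub, one_mul]
    refine ⟨?_, ih1⟩
    have h2 : (e : ℂ) + Complex.I * lam * -1 = μ + μ⁻¹ := by rw [hμ]; ring
    rw [h2]
    linear_combination (μ + μ⁻¹) * ih1 - ih2 + (1 - κ * μ⁻¹) * μ ^ n * h1
      + (κ * μ - 1) * μ⁻¹ ^ n * h1

theorem tendsto_inv_pow_zero (h : 1 < ‖μ‖) : Tendsto (fun n : ℕ => (μ⁻¹ ^ 2) ^ n) atTop (𝓝 0) := by
  apply tendsto_pow_atTop_nhds_zero_of_norm_lt_one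
  rw [norm_pow, norm_inv]
  exact pow_lt_one₀ (by positivity) (inv_lt_one_of_one_lt₀ h) two_ne_zero

theorem tendsto_log_norm_div (h : 1 < ‖μ‖) {A B : ℂ} (hA : A ≠ 0) :
    Tendsto (fun n : ℕ => 1 / (n : ℝ) * Real.log ‖A * μ ^ n + B * μ⁻¹ ^ n‖) atTop
      (𝓝 (Real.log ‖μ‖)) := by
  have h0 := (one_lt_norm_sub_inv_ne_zero h).1
  have hfac : ∀ n : ℕ, A * μ ^ n + B * μ⁻¹ ^ n = μ ^ n * (A + B * (μ⁻¹ ^ 2) ^ n) := by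
    intro n
    have h1 : μ ^ n * μ⁻¹ ^ n = 1 := by rw [← mul_pow, mul_inv_cancel₀ h0, one_pow]
    rw [← pow_mul, mul_comm 2 n, pow_mul]
    linear_combination (-(B * μ⁻¹ ^ n)) * h1
  have hlim : Tendsto (fun n : ℕ => A + B * (μ⁻¹ ^ 2) ^ n) atTop (𝓝 A) := by
    simpa using ((tendsto_inv_pow_zero h).const_mul B).const_add A
  have hlog : Tendsto (fun n : ℕ => Real.log ‖A + B * (μ⁻¹ ^ 2) ^ n‖) atTop (𝓝 (Real.log ‖A‖)) :=
    (hlim.norm).log (norm_ne_zero_iff.mpr hA)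
  have hsmall : Tendsto (fun n : ℕ => 1 / (n : ℝ) * Real.log ‖A + B * (μ⁻¹ ^ 2) ^ n‖) atTop (𝓝 0) := by
    simpa using tendsto_one_div_atTop_nhds_zero_nat.mul hlog
  have hsum := hsmall.const_add (Real.log ‖μ‖)
  rw [add_zero] at hsum
  refine hsum.congr' ?_
  have hne : ∀ᶠ n : ℕ in atTop, A + B * (μ⁻¹ ^ 2) ^ n ≠ 0 := hlim.eventually_ne hA
  filter_upwards [hne, eventually_gt_atTop 0] with n hn hn0
  have hn0' : (n : ℝ) ≠ 0 := by exact_mod_cast hn0.ne'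
  rw [hfac, norm_mul, Real.log_mul (norm_ne_zero_iff.mpr (pow_ne_zero _ h0))
    (norm_ne_zero_iff.mpr hn), norm_pow, Real.log_pow]
  field_simp

/-- The integral of ln‖A_n‖ differs by a bounded amount from the logarithm of a value at the centre
of the disc, and that value grows like μ^n. -/
theorem lyapunovExponent_eq (hlam : 0 < lam) (α : ℝ) (h : 1 < ‖μ‖)
    (hμ : μ + μ⁻¹ = e - Complex.I * lam) : lyapunovExponent lam α e = Real.log ‖μ‖ := by
  obtain ⟨h0, hd⟩ := one_lt_norm_sub_inv_ne_zero h
  apply Tendsto.limUnder_eq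
  have hI : μ - Complex.I ≠ 0 := by
    intro hz
    rw [sub_eq_zero.mp hz, Complex.norm_I] at h
    exact lt_irrefl _ h
  set A : ℂ := (1 - Complex.I * μ⁻¹) * (μ - Complex.I) / (μ - μ⁻¹) with hAdef
  set B : ℂ := (Complex.I * μ - 1) * (μ⁻¹ - Complex.I) / (μ - μ⁻¹) with hBdef
  -- A is a nonzero multiple of (μ - i)², and |μ| > 1 = |i|.
  have hA : A ≠ 0 := by
    have : (1 - Complex.I * μ⁻¹) = (μ - Complex.I) * μ⁻¹ := by field_simp
    rw [hAdef, this]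
    exact div_ne_zero (mul_ne_zero (mul_ne_zero hI (inv_ne_zero h0)) hI) hd
  have hval : ∀ n, cocycleNum lam e (unitExp α) Complex.I n 0
      - Complex.I * cocycleDen lam e (unitExp α) Complex.I n 0 = A * μ ^ n + B * μ⁻¹ ^ n := by
    intro n
    obtain ⟨h1, h2⟩ := cocycle_at_zero (lam := lam) (e := e) h hμ (unitExp α) Complex.I n
    have hA' : (μ - μ⁻¹) * A = (1 - Complex.I * μ⁻¹) * (μ - Complex.I) := mul_div_cancel₀ _ hd
    have hB' : (μ - μ⁻¹) * B = (Complex.I * μ - 1) * (μ⁻¹ - Complex.I) := mul_div_cancel₀ _ hd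
    apply mul_left_cancel₀ hd
    rw [mul_sub, h1]
    linear_combination (-Complex.I) * h2 - μ ^ n * hA' - μ⁻¹ ^ n * hB'
  have hmain := tendsto_log_norm_div h (A := A) (B := B) hA
  have herr : Tendsto (fun n : ℕ => 1 / (n : ℝ) * ((∫ x in (0 : ℝ)..1,
      Real.log ‖Matrix.toEuclideanCLM (n := Fin 2) (𝕜 := ℝ) (transferProduct lam α e n x)‖)
      - Real.log ‖A * μ ^ n + B * μ⁻¹ ^ n‖)) atTop (𝓝 0) := by
    have hb : Tendsto (fun n : ℕ => 1 / (n : ℝ) * Real.log 4) atTop (𝓝 0) := by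
      simpa using tendsto_one_div_atTop_nhds_zero_nat.mul_const (Real.log 4)
    refine squeeze_zero_norm (fun n => ?_) hb
    rw [norm_mul, Real.norm_of_nonneg (by positivity : (0 : ℝ) ≤ 1 / n), ← hval]
    exact mul_le_mul_of_nonneg_left
      (abs_integral_log_norm_transferProduct_sub_le lam α e hlam n) (by positivity)
  have := herr.add hmain
  rw [zero_add] at this
  refine this.congr fun n => ?_
  ring

/-- The Riccati ratio along the first column of the transfer matrices. -/
noncomputable def sturmRatio (lam α e : ℝ) (n : ℕ) (x : ℝ) : ℝ :=
  transferProduct lam α e (n + 1) x 0 0 / transferProduct lam α e (n + 1) x 1 0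

/-- The first column of the transfer matrices solves the Dirichlet recursion, so its successive
ratios are the pivots of the Sturm count as long as no entry vanishes. -/
theorem boxCount_eq_sum_sturmRatio (lam α e x : ℝ) (N : ℕ)
    (h : ∀ n ≤ N, transferProduct lam α e n x 0 0 ≠ 0) :
    (boxCount lam α e x N : ℝ) =
      ∑ n ∈ Finset.range N, if 0 < sturmRatio lam α e n x then (1 : ℝ) else 0 := by
  classical
  have h10 : ∀ n, transferProduct lam α e (n + 1) x 1 0 = transferProduct lam α e n x 0 0 := by
    intro n
    simp [transferProduct, transferMatrix, Matrix.mul_apply, Fin.sum_univ_two]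
  have h00 : ∀ n, transferProduct lam α e (n + 1) x 0 0 =
      (e - lam * Real.tan (Real.pi * (x + n * α))) * transferProduct lam α e n x 0 0
        - transferProduct lam α e n x 1 0 := by
    intro n
    simp [transferProduct, transferMatrix, Matrix.mul_apply, Fin.sum_univ_two]
    ring
  rw [boxCount_eq_card_pos lam α e x N (fun n => sturmRatio lam α e n x)
    (fun n => transferProduct lam α e n x 1 0 / transferProduct lam α e n x 0 0)]
  · rw [Finset.sum_range, Finset.sum_boole, Nat.card_eq_fintype_card, Fintype.card_subtype]
  · simp [transferProduct]
  · intro n _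
    rw [sturmRatio, one_div_div]
  · intro n hn
    have := h n hn.le
    rw [sturmRatio, h10, h00]
    field_simp
  · intro n hn
    rw [sturmRatio, h10]
    exact div_ne_zero (h _ hn) (h _ hn.le)

/-- The ratio F of the two polynomials maps the disc to the lower half-plane, so arg F = Im log F is
harmonic with values in (-π, 0). Its radial limits are almost everywhere 0 or -π according to the
sign of the Sturm ratio, and its mean over the circle is its value at the centre. The index n + 1
keeps the denominator nonzero, since for κ = 0 it vanishes at index 0. -/
theorem integral_sturmRatio_pos (hlam : 0 < lam) (α : ℝ) (n : ℕ) :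
    IntervalIntegrable (fun x => if 0 < sturmRatio lam α e n x then (1 : ℝ) else 0) volume 0 1 ∧
    ∫ x in (0 : ℝ)..1, (if 0 < sturmRatio lam α e n x then (1 : ℝ) else 0) =
      1 + (cocycleNum lam e (unitExp α) 0 (n + 1) 0
        / cocycleDen lam e (unitExp α) 0 (n + 1) 0).arg / Real.pi := by
  set ζ := unitExp α
  have hζ : ‖ζ‖ = 1 := norm_unitExp α
  let P := (cocyclePoly lam e ζ 0 (n + 1)).1
  let Q := (cocyclePoly lam e ζ 0 (n + 1)).2
  let F : ℂ → ℂ := fun z => P.eval z / Q.eval z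
  have him : ∀ z : ℂ, ‖z‖ < 1 → (F z).im < 0 ∧ Q.eval z ≠ 0 := by
    intro z hz
    have h1 := cocycle_im_neg e hlam hζ (κ := 0) (by simp) hz n
    obtain ⟨h2, h3⟩ := ne_zero_of_im_mul_conj_neg h1
    refine ⟨?_, h3⟩
    have h4 : F z = (P.eval z * (starRingEnd ℂ) (Q.eval z)) * ((Complex.normSq (Q.eval z))⁻¹ : ℝ) := by
      simp only [F]
      rw [div_eq_mul_inv, Complex.inv_def]
      ring
    rw [h4, Complex.im_mul_ofReal]
    exact mul_neg_of_neg_of_pos h1 (inv_pos.mpr (Complex.normSq_pos.mpr h3))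
  have hQ0 : Q ≠ 0 := by rintro h; exact (him 0 (by simp)).2 (by simp [h])
  have hP0 : P ≠ 0 := by
    rintro h
    have := (him 0 (by simp)).1
    simp [F, h] at this
  let W : Polynomial ℂ := ∏ j ∈ Finset.range (n + 1), (1 + Polynomial.C (ζ ^ j) * Polynomial.X)
  have hWe : ∀ z, W.eval z = ∏ j ∈ Finset.range (n + 1), (1 + ζ ^ j * z) := by
    intro z; simp [W, Polynomial.eval_prod]
  have hW0 : W ≠ 0 := by
    rintro h
    have := hWe 0
    rw [h] at this
    simp at this
  -- mean value property inside the disc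
  have hmean : ∀ r ∈ Set.Ioo (0 : ℝ) 1, ∫ x in (0 : ℝ)..1, (F (r * unitExp x)).arg = (F 0).arg := by
    intro r hr
    have hd : DifferentiableOn ℂ (fun z => Complex.log (F z)) (Metric.ball 0 1) := by
      intro z hz
      have hz' : ‖z‖ < 1 := by simpa using hz
      have h1 := him z hz'
      refine DifferentiableAt.differentiableWithinAt ?_
      refine DifferentiableAt.clog ?_ (Or.inr h1.1.ne)
      exact (P.differentiable z).div (Q.differentiable z) h1.2
    have hdc : DiffContOnCl ℂ (fun z => Complex.log (F z)) (Metric.ball 0 |r|) := by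
      refine hd.diffContOnCl_ball ?_
      rw [abs_of_pos hr.1]
      intro z hz
      have : ‖z‖ ≤ r := by simpa using hz
      simpa using this.trans_lt hr.2
    have hav := hdc.circleAverage
    rw [Real.circleAverage_def] at hav
    have hcv := intervalIntegral.integral_comp_mul_left (a := 0) (b := 1)
      (fun t => Complex.log (F (circleMap 0 r t))) (c := 2 * Real.pi) (by positivity)
    simp only [mul_zero, mul_one] at hcv
    rw [← hcv] at hav
    have hcm : ∀ x : ℝ, circleMap 0 r (2 * Real.pi * x) = r * unitExp x := by
      intro x
      rw [← circleMap_eq_unitExp]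
      simp [circleMap]
    simp only [hcm] at hav
    have hcont : Continuous fun x : ℝ => Complex.log (F (r * unitExp x)) := by
      have hu : Continuous fun x : ℝ => (r : ℂ) * unitExp x := by
        simp only [unitExp]; fun_prop
      refine hd.continuousOn.comp_continuous hu fun x => ?_
      simpa [norm_unitExp, abs_of_pos hr.1] using hr.2
    have := congrArg Complex.im hav
    rw [Complex.log_im] at this
    rw [← this]
    have h2 := Complex.imCLM.intervalIntegral_comp_comm (hcont.intervalIntegrable (μ := volume) 0 1)
    simpa [Complex.log_im] using h2
  -- boundary values
  have hbd : ∀ᵐ x : ℝ, Tendsto (fun r : ℝ => (F (r * unitExp x)).arg) (𝓝[<] 1)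
      (𝓝 (if 0 < sturmRatio lam α e n x then 0 else -Real.pi)) := by
    filter_upwards [ae_eval_unitExp_ne_zero hP0, ae_eval_unitExp_ne_zero hQ0,
      ae_eval_unitExp_ne_zero hW0] with x hxP hxQ hxW
    have hxj : ∀ j < n + 1, 1 + ζ ^ j * unitExp x ≠ 0 := by
      intro j hj
      rw [hWe, Finset.prod_ne_zero_iff] at hxW
      exact hxW j (Finset.mem_range.mpr hj)
    obtain ⟨h1, h2⟩ := transferProduct_mul_prod lam α e x 0 (n + 1) hxj
    rw [← hWe] at h1 h2
    have hF : F (unitExp x) = (sturmRatio lam α e n x : ℂ) := by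
      change cocycleNum lam e ζ 0 (n + 1) (unitExp x) / cocycleDen lam e ζ 0 (n + 1) (unitExp x) = _
      rw [← h1, ← h2, mul_div_mul_right _ _ hxW, sturmRatio]
      simp
    have hne : sturmRatio lam α e n x ≠ 0 := by
      intro h0
      rw [h0] at hF
      exact div_ne_zero hxP hxQ (hF.trans Complex.ofReal_zero)
    have hr1 : Tendsto (fun r : ℝ => (r : ℂ) * unitExp x) (𝓝[<] 1) (𝓝 (unitExp x)) := by
      have : Continuous fun r : ℝ => (r : ℂ) * unitExp x := by fun_prop
      have h3 := this.tendsto 1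
      simp only [Complex.ofReal_one, one_mul] at h3
      exact h3.mono_left nhdsWithin_le_nhds
    have hFc : ContinuousAt F (unitExp x) :=
      (P.continuous.continuousAt).div (Q.continuous.continuousAt) hxQ
    have hFt : Tendsto (fun r : ℝ => F (r * unitExp x)) (𝓝[<] 1) (𝓝 (sturmRatio lam α e n x : ℂ)) := by
      rw [← hF]; exact hFc.tendsto.comp hr1
    split_ifs with hpos
    · have := (Complex.continuousAt_arg (x := (sturmRatio lam α e n x : ℂ))
        (Or.inl (by simpa using hpos))).tendsto.comp hFt
      rwa [Complex.arg_ofReal_of_nonneg hpos.le] at this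
    · have hneg : sturmRatio lam α e n x < 0 := lt_of_le_of_ne (not_lt.mp hpos) hne
      -- The argument jumps across the negative axis; approaching from the lower half-plane selects
      -- -π.
      refine (Complex.tendsto_arg_nhdsWithin_im_neg_of_re_neg_of_im_zero
        (z := (sturmRatio lam α e n x : ℂ)) (by simpa using hneg) (by simp)).comp ?_
      refine tendsto_nhdsWithin_iff.mpr ⟨hFt, ?_⟩
      have hio : Set.Ioo (0 : ℝ) 1 ∈ 𝓝[<] (1 : ℝ) := Ioo_mem_nhdsLT zero_lt_one
      filter_upwards [hio] with r hr
      refine (him _ ?_).1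
      simpa [norm_unitExp, abs_of_pos hr.1] using hr.2
  have hmeas : Measurable fun x => sturmRatio lam α e n x := by
    unfold sturmRatio
    exact (measurable_transferProduct lam α e _ 0 0).div (measurable_transferProduct lam α e _ 1 0)
  have hint : IntervalIntegrable (fun x => if 0 < sturmRatio lam α e n x then (1 : ℝ) else 0)
      volume 0 1 := by
    refine (intervalIntegrable_const (c := (1 : ℝ))).mono_fun ?_ ?_
    · exact (Measurable.ite (measurableSet_lt measurable_const hmeas) measurable_const
        measurable_const).aestronglyMeasurable
    · refine Eventually.of_forall fun x => ?_
      dsimp only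
      split_ifs <;> simp
  refine ⟨hint, ?_⟩
  have hlim := intervalIntegral.tendsto_integral_filter_of_dominated_convergence (a := (0 : ℝ)) (b := 1)
    (μ := volume) (l := 𝓝[<] (1 : ℝ)) (F := fun r x => (F (r * unitExp x)).arg)
    (f := fun x => if 0 < sturmRatio lam α e n x then 0 else -Real.pi) (fun _ => Real.pi)
    (by
      refine Eventually.of_forall fun r => ?_
      refine Measurable.aestronglyMeasurable ?_
      refine Complex.measurable_arg.comp ?_
      have hu : Measurable fun x : ℝ => (r : ℂ) * unitExp x := by
        have : Continuous fun x : ℝ => (r : ℂ) * unitExp x := by simp only [unitExp]; fun_prop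
        exact this.measurable
      exact (P.continuous.measurable.comp hu).div (Q.continuous.measurable.comp hu))
    (by
      refine Eventually.of_forall fun r => Eventually.of_forall fun x _ => ?_
      rw [Real.norm_eq_abs]
      exact Complex.abs_arg_le_pi _)
    intervalIntegrable_const
    (by filter_upwards [hbd] with x hx _ using hx)
  have hconst : Tendsto (fun r : ℝ => ∫ x in (0 : ℝ)..1, (F (r * unitExp x)).arg) (𝓝[<] 1)
      (𝓝 (F 0).arg) := by
    refine tendsto_const_nhds.congr' ?_
    filter_upwards [Ioo_mem_nhdsLT zero_lt_one] with r hr using (hmean r hr).symm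
  have heq := tendsto_nhds_unique hlim hconst
  have hrew : ∀ x, (if 0 < sturmRatio lam α e n x then 0 else -Real.pi) =
      Real.pi * (if 0 < sturmRatio lam α e n x then (1 : ℝ) else 0) - Real.pi := by
    intro x; split_ifs <;> ring
  simp only [hrew] at heq
  rw [intervalIntegral.integral_sub (hint.const_mul _) intervalIntegrable_const,
    intervalIntegral.integral_const_mul] at heq
  simp only [intervalIntegral.integral_const, sub_zero, one_smul] at heq
  change _ = 1 + (F 0).arg / Real.pi
  have hpi := Real.pi_ne_zero
  rw [← heq]
  field_simp
  ring

/-- The ratio at the centre converges to the dominant eigenvalue μ, and arg is continuous there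
because Im μ < 0. The averaged count per site is the Cesàro mean of the convergent sequence 1 + arg
F_n(0)/π. -/
theorem integratedDensityOfStates_eq (hlam : 0 < lam) (α : ℝ) (h : 1 < ‖μ‖) (him : μ.im < 0)
    (hμ : μ + μ⁻¹ = e - Complex.I * lam) :
    integratedDensityOfStates lam α e = 1 + μ.arg / Real.pi := by
  obtain ⟨h0, hd⟩ := one_lt_norm_sub_inv_ne_zero h
  apply Tendsto.limUnder_eq
  have hratio : Tendsto (fun n : ℕ => cocycleNum lam e (unitExp α) 0 (n + 1) 0
        / cocycleDen lam e (unitExp α) 0 (n + 1) 0) atTop (𝓝 μ) := by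
    have hval : ∀ n : ℕ, cocycleNum lam e (unitExp α) 0 (n + 1) 0
        / cocycleDen lam e (unitExp α) 0 (n + 1) 0 =
        (μ - μ⁻¹ ^ 3 * (μ⁻¹ ^ 2) ^ n) / (1 - μ⁻¹ ^ 2 * (μ⁻¹ ^ 2) ^ n) := by
      intro n
      obtain ⟨h1, h2⟩ := cocycle_at_zero (lam := lam) (e := e) h hμ (unitExp α) 0 (n + 1)
      simp only [zero_mul, sub_zero, one_mul, zero_sub] at h1 h2
      have h4 : μ * μ⁻¹ = 1 := mul_inv_cancel₀ h0
      rw [← mul_div_mul_left _ _ hd, h1, h2, ← mul_div_mul_left (μ - _) _ (pow_ne_zero (n + 1) h0)]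
      clear h1 h2 hμ h him
      generalize μ⁻¹ = ν at *
      have h3 : μ ^ (n + 1) * (ν ^ 2) ^ n * ν = ν ^ n := by
        have : μ ^ n * ν ^ n = 1 := by rw [← mul_pow, h4, one_pow]
        rw [← pow_mul, mul_comm 2 n, pow_mul]
        linear_combination (μ * ν * ν ^ n) * this + ν ^ n * h4
      congr 1
      · linear_combination ν ^ 2 * h3
      · linear_combination ν * h3
    simp only [hval]
    have hp := tendsto_inv_pow_zero h
    have hn : Tendsto (fun n : ℕ => μ - μ⁻¹ ^ 3 * (μ⁻¹ ^ 2) ^ n) atTop (𝓝 μ) := by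
      have := (hp.const_mul (μ⁻¹ ^ 3)).const_sub μ
      rwa [mul_zero, sub_zero] at this
    have hdn : Tendsto (fun n : ℕ => 1 - μ⁻¹ ^ 2 * (μ⁻¹ ^ 2) ^ n) atTop (𝓝 1) := by
      have := (hp.const_mul (μ⁻¹ ^ 2)).const_sub 1
      rwa [mul_zero, sub_zero] at this
    have := hn.div hdn one_ne_zero
    rwa [div_one] at this
  have harg : Tendsto (fun n : ℕ => 1 + (cocycleNum lam e (unitExp α) 0 (n + 1) 0
        / cocycleDen lam e (unitExp α) 0 (n + 1) 0).arg / Real.pi) atTop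
      (𝓝 (1 + μ.arg / Real.pi)) :=
    (((Complex.continuousAt_arg (Or.inr him.ne)).tendsto.comp hratio).div_const _).const_add 1
  refine harg.cesaro.congr fun N => ?_
  rw [one_div]
  congr 1
  have hsum : ∫ x in (0 : ℝ)..1, (boxCount lam α e x N : ℝ) = ∫ x in (0 : ℝ)..1,
      ∑ n ∈ Finset.range N, if 0 < sturmRatio lam α e n x then (1 : ℝ) else 0 := by
    refine intervalIntegral.integral_congr_ae ?_
    -- The exceptional phases are zeros of countably many nonzero polynomials on the circle.
    have hne : ∀ n : ℕ, ∀ᵐ x : ℝ, transferProduct lam α e n x 0 0 ≠ 0 := by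
      intro n
      let W : Polynomial ℂ := ∏ j ∈ Finset.range n,
        (1 + Polynomial.C (unitExp α ^ j) * Polynomial.X)
      have hWe : ∀ z, W.eval z = ∏ j ∈ Finset.range n, (1 + unitExp α ^ j * z) := by
        intro z; simp [W, Polynomial.eval_prod]
      have hW0 : W ≠ 0 := by
        rintro hW
        have := hWe 0
        rw [hW] at this
        simp at this
      have hP0 : (cocyclePoly lam e (unitExp α) 0 n).1 ≠ 0 := by
        intro hP
        refine (cocycle_im_nonpos e hlam (norm_unitExp α) (κ := 0) (by simp) (z := 0) (by simp) n).2 ?_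
        simp [cocycleNum, hP]
      filter_upwards [ae_eval_unitExp_ne_zero hP0, ae_eval_unitExp_ne_zero hW0] with x hxP hxW
      have hxj : ∀ j < n, 1 + unitExp α ^ j * unitExp x ≠ 0 := by
        intro j hj
        rw [hWe, Finset.prod_ne_zero_iff] at hxW
        exact hxW j (Finset.mem_range.mpr hj)
      have h1 := (transferProduct_mul_prod lam α e x 0 n hxj).1
      intro hz
      apply hxP
      change cocycleNum lam e (unitExp α) 0 n (unitExp x) = 0
      rw [← h1, hz]; simp
    filter_upwards [ae_all_iff.mpr hne] with x hx _
    exact boxCount_eq_sum_sturmRatio lam α e x N fun n _ => hx n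
  rw [hsum, intervalIntegral.integral_finsetSum fun n _ => (integral_sturmRatio_pos hlam α n).1]
  exact Finset.sum_congr rfl fun n _ => (integral_sturmRatio_pos hlam α n).2.symm

end
end

/-! ### Convergents, exponential sums and small divisors. -/

section
open Filter Topology

/-- The continued fraction approximants of an irrational number, with integer entries, and the
properties of them that are used. -/
theorem exists_convergents {α : ℝ} (hα : Irrational α) :
    ∃ (q : ℕ → ℕ) (p : ℕ → ℤ), (∀ n, cfDen α n = q n) ∧ (∀ n, 0 < q n) ∧
      (∀ n, q n ≤ q (n + 1)) ∧ (∀ n, q n + q (n + 1) ≤ q (n + 2)) ∧ (∀ n, |q n * α - p n| ≤ 1 / q (n + 1)) ∧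
      (∀ n, |p n * q (n + 1) - q n * p (n + 1)| = 1) ∧ Tendsto q atTop atTop := by
  have hnt : ∀ n, ¬ (GenContFract.of α).TerminatedAt n := by
    intro n hn
    obtain ⟨r, hr⟩ := GenContFract.exists_rat_eq_of_terminates ⟨n, hn⟩
    exact hα ⟨r, hr.symm⟩
  have hs : ∀ n, ∃ z : ℤ, 1 ≤ z ∧ (GenContFract.of α).s.get? n = some ⟨1, (z : ℝ)⟩ := by
    intro n
    obtain ⟨gp, hgp⟩ : ∃ gp, (GenContFract.of α).s.get? n = some gp :=
      Option.ne_none_iff_exists'.mp (hnt n)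
    obtain ⟨h1, z, hz⟩ := GenContFract.of_partNum_eq_one_and_exists_int_partDen_eq hgp
    refine ⟨z, ?_, ?_⟩
    · have := GenContFract.of_one_le_get?_partDen (GenContFract.partDen_eq_s_b hgp)
      rw [hz] at this
      exact_mod_cast this
    · rw [hgp, ← h1, ← hz]
  have hint : ∀ n, (∃ P : ℤ, (GenContFract.of α).nums n = P) ∧
      (∃ Q : ℕ, (GenContFract.of α).dens n = Q ∧ 0 < Q) := by
    intro n
    induction n using Nat.twoStepInduction with
    | zero =>
      refine ⟨⟨⌊α⌋, ?_⟩, 1, ?_, one_pos⟩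
      · simp [GenContFract.of_h_eq_floor]
      · simp
    | one =>
      obtain ⟨z, hz1, hz⟩ := hs 0
      refine ⟨⟨z * ⌊α⌋ + 1, ?_⟩, z.toNat, ?_, by omega⟩
      · rw [GenContFract.first_num_eq hz]
        simp [GenContFract.of_h_eq_floor]
      · rw [GenContFract.first_den_eq hz]
        have : ((z.toNat : ℤ) : ℝ) = z := by rw [Int.toNat_of_nonneg (by omega)]
        change (z : ℝ) = _
        exact_mod_cast this.symm
    | more n ih1 ih2 =>
      obtain ⟨z, hz1, hz⟩ := hs (n + 1)
      obtain ⟨⟨P1, hP1⟩, Q1, hQ1, hQ1p⟩ := ih1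
      obtain ⟨⟨P2, hP2⟩, Q2, hQ2, hQ2p⟩ := ih2
      refine ⟨⟨z * P2 + P1, ?_⟩, z.toNat * Q2 + Q1, ?_, by omega⟩
      · rw [GenContFract.nums_recurrence hz hP1 hP2]; push_cast; ring
      · rw [GenContFract.dens_recurrence hz hQ1 hQ2]
        have : ((z.toNat : ℤ) : ℝ) = z := by rw [Int.toNat_of_nonneg (by omega)]
        rw [← this]; push_cast; ring
  choose p hp using fun n => (hint n).1
  choose q hq hqpos using fun n => (hint n).2
  refine ⟨q, p, hq, hqpos, ?_, ?_, ?_, ?_, ?_⟩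
  · intro n
    have := GenContFract.of_den_mono (v := α) (n := n)
    rw [hq, hq] at this
    exact_mod_cast this
  · intro n
    obtain ⟨z, hz1, hz⟩ := hs (n + 1)
    have h1 := GenContFract.dens_recurrence hz (hq n) (hq (n + 1))
    rw [hq] at h1
    have h2 : (1 : ℝ) ≤ z := by exact_mod_cast hz1
    have h3 : (q n : ℝ) + q (n + 1) ≤ q (n + 2) := by
      rw [h1]
      have : (0 : ℝ) ≤ q (n + 1) := by positivity
      nlinarith
    exact_mod_cast h3
  · intro n
    have h1 := GenContFract.abs_sub_convs_le (hnt n)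
    rw [GenContFract.conv_eq_num_div_den, hp, hq, hq] at h1
    have hq0 : (0 : ℝ) < q n := by exact_mod_cast hqpos n
    have hq1 : (0 : ℝ) < q (n + 1) := by exact_mod_cast hqpos (n + 1)
    have h2 : (q n : ℝ) * α - p n = q n * (α - p n / q n) := by field_simp
    rw [h2, abs_mul, abs_of_pos hq0]
    calc (q n : ℝ) * |α - p n / q n| ≤ q n * (1 / (q n * q (n + 1))) := by gcongr
      _ = 1 / q (n + 1) := by field_simp
  · intro n
    have h1 := SimpContFract.determinant (s := SimpContFract.of α) (n := n) (hnt n)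
    change (GenContFract.of α).nums n * (GenContFract.of α).dens (n + 1)
      - (GenContFract.of α).dens n * (GenContFract.of α).nums (n + 1) = _ at h1
    rw [hp, hp, hq, hq] at h1
    have h2 : (p n * q (n + 1) - q n * p (n + 1) : ℤ) = (-1) ^ (n + 1) := by exact_mod_cast h1
    rw [h2, abs_pow, abs_neg, abs_one, one_pow]
  · refine tendsto_atTop_mono' atTop ?_ (tendsto_sub_atTop_nat 1)
    filter_upwards [eventually_gt_atTop 0] with n hn
    have h1 := GenContFract.succ_nth_fib_le_of_nth_den (v := α) (n := n) (Or.inr (hnt _))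
    rw [hq] at h1
    have h2 : Nat.fib (n + 1) ≤ q n := by exact_mod_cast h1
    have h3 := Nat.le_fib_add_one n
    have h4 := Nat.fib_le_fib_succ (n := n)
    omega

theorem norm_unitExp_sub_unitExp_le (x y : ℝ) : ‖unitExp x - unitExp y‖ ≤ 2 * Real.pi * |x - y| := by
  have h : unitExp x - unitExp y = unitExp y * (unitExp (x - y) - 1) := by
    rw [mul_sub, ← unitExp_add]; simp
  rw [h, norm_mul, norm_unitExp, one_mul, unitExp]
  have := Real.norm_exp_I_mul_ofReal_sub_one_le (x := 2 * Real.pi * (x - y))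
  rw [Real.norm_eq_abs, abs_mul, abs_of_pos (by positivity : (0 : ℝ) < 2 * Real.pi)] at this
  convert this using 4
  push_cast; ring

@[simp] theorem unitExp_intCast (n : ℤ) : unitExp n = 1 := by
  have := (unitExp_eq_unitExp_iff n 0).mpr ⟨n, by simp⟩
  rw [this]; simp [unitExp]

theorem unitExp_intCast_mul (n : ℤ) (x : ℝ) : unitExp (n * x) = unitExp x ^ n := by
  rw [unitExp, unitExp, ← Complex.exp_int_mul]; congr 1; push_cast; ring

theorem norm_unitExp_sub_one_le (x : ℝ) (l : ℤ) : ‖unitExp x - 1‖ ≤ 2 * Real.pi * |x - l| := by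
  have := norm_unitExp_sub_unitExp_le x l
  rwa [unitExp_intCast] at this

/-- |e(y) - 1| = 2|sin πy| ≥ 4|y| for |y| ≤ 1/2, by Jordan's inequality. -/
theorem le_norm_unitExp_sub_one {x c : ℝ} (h : ∀ l : ℤ, c ≤ |x - l|) :
    4 * c ≤ ‖unitExp x - 1‖ := by
  have h1 := h (round x)
  set y := x - round x with hy
  have h2 : |y| ≤ 1 / 2 := abs_sub_round x
  have h3 : unitExp x = unitExp y := (unitExp_eq_unitExp_iff x y).mpr ⟨round x, by rw [hy]; ring⟩
  have h4 : ‖unitExp y - 1‖ = 2 * |Real.sin (Real.pi * y)| := by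
    have := Complex.norm_exp_I_mul_ofReal_sub_one (2 * Real.pi * y)
    rw [Real.norm_eq_abs, abs_mul, abs_of_pos (two_pos : (0 : ℝ) < 2)] at this
    rw [show 2 * Real.pi * y / 2 = Real.pi * y by ring] at this
    rw [← this, unitExp]
    congr 3
    push_cast; ring
  have h5 : 2 * |y| ≤ |Real.sin (Real.pi * y)| := by
    have := Real.mul_abs_le_abs_sin (x := Real.pi * y) (by
      rw [abs_mul, abs_of_pos Real.pi_pos]; nlinarith [Real.pi_pos])
    rw [abs_mul, abs_of_pos Real.pi_pos] at this
    have hpi := Real.pi_ne_zero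
    calc 2 * |y| = 2 / Real.pi * (Real.pi * |y|) := by field_simp
      _ ≤ _ := this
  rw [h3, h4]
  linarith

/-- Exponential sums of length the denominator of a rational approximation. -/
theorem norm_sum_unitExp_sub_le {α : ℝ} {q q' : ℕ} {p : ℤ} (hq : 0 < q) (hcop : IsCoprime p (q : ℤ))
    (happ : |q * α - p| ≤ 1 / q') (k : ℤ) :
    ‖∑ j ∈ Finset.range q, unitExp (j * (k * α)) - (if (q : ℤ) ∣ k then (q : ℂ) else 0)‖ ≤
      2 * Real.pi * q * |(k : ℝ)| / q' := by
  have hqR : (0 : ℝ) < q := by exact_mod_cast hq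
  -- With p/q in place of α the geometric sum is exactly q or 0; each of the q terms then moves by
  -- at most 2π|k|/q'.
  have hrat : ∑ j ∈ Finset.range q, unitExp (j * (k * p / q)) =
      if (q : ℤ) ∣ k then (q : ℂ) else 0 := by
    simp only [unitExp_natCast_mul]
    split_ifs with hdvd
    · obtain ⟨m, rfl⟩ := hdvd
      have : unitExp (((q : ℤ) * m : ℤ) * p / q) = 1 := by
        have h1 : (((q : ℤ) * m : ℤ) * p / q : ℝ) = ((m * p : ℤ) : ℝ) := by
          push_cast; field_simp
        rw [h1, unitExp_intCast]
      simp only [this, one_pow, Finset.sum_const, Finset.card_range, nsmul_eq_mul, mul_one]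
    · have hne : unitExp (k * p / q) ≠ 1 := by
        intro h1
        have h2 : unitExp (k * p / q) = unitExp 0 := by rw [h1]; simp [unitExp]
        obtain ⟨n, hn⟩ := (unitExp_eq_unitExp_iff _ _).mp h2
        rw [zero_add, div_eq_iff hqR.ne'] at hn
        have h3 : k * p = n * q := by exact_mod_cast hn
        exact hdvd (hcop.symm.dvd_of_dvd_mul_right ⟨n, by rw [h3, mul_comm]⟩)
      rw [geom_sum_eq hne, ← unitExp_natCast_mul]
      have : (q : ℝ) * (k * p / q) = ((k * p : ℤ) : ℝ) := by push_cast; field_simp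
      rw [this, unitExp_intCast, sub_self, zero_div]
  rw [← hrat, ← Finset.sum_sub_distrib]
  refine (norm_sum_le _ _).trans ?_
  have hterm : ∀ j ∈ Finset.range q, ‖unitExp (j * (k * α)) - unitExp (j * (k * p / q))‖ ≤
      2 * Real.pi * |(k : ℝ)| / q' := by
    intro j hj
    refine (norm_unitExp_sub_unitExp_le _ _).trans ?_
    have hj' : (j : ℝ) ≤ q := by exact_mod_cast (Finset.mem_range.mp hj).le
    have h1 : (j : ℝ) * (k * α) - j * (k * p / q) = (j / q) * (k * (q * α - p)) := by field_simp
    rw [h1, abs_mul, abs_mul, abs_of_nonneg (by positivity : (0 : ℝ) ≤ j / q), mul_div_assoc]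
    gcongr 2 * Real.pi * ?_
    calc (j : ℝ) / q * (|(k : ℝ)| * |q * α - p|) ≤ 1 * (|(k : ℝ)| * (1 / q')) := by
          gcongr
          exact (div_le_one hqR).mpr hj'
      _ = |(k : ℝ)| / q' := by ring
  refine (Finset.sum_le_sum hterm).trans (le_of_eq ?_)
  rw [Finset.sum_const, Finset.card_range, nsmul_eq_mul]
  ring

/-- Small divisor bounds between two consecutive denominators. -/
theorem le_norm_unitExp_sub_one_of_le {α : ℝ} {q q' : ℕ} {p : ℤ} (hq : 0 < q) (hq' : 0 < q')
    (hcop : IsCoprime p (q : ℤ)) (happ : |q * α - p| ≤ 1 / q') (hlow : 1 / (2 * q') ≤ |q * α - p|)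
    {k : ℤ} (hk0 : k ≠ 0) (hk : 2 * |(k : ℝ)| ≤ q') :
    (if (q : ℤ) ∣ k then 2 / (q' : ℝ) else 2 / (q : ℝ)) ≤ ‖unitExp (k * α) - 1‖ := by
  have hqR : (0 : ℝ) < q := by exact_mod_cast hq
  have hq1 : (1 : ℝ) ≤ q := by exact_mod_cast hq
  have hqR' : (0 : ℝ) < q' := by exact_mod_cast hq'
  have hq1' : (1 : ℝ) ≤ q' := by exact_mod_cast hq'
  -- The reason for the range 2|k| ≤ q': kα lies within 1/(2q) of kp/q, so the distance of kα to the
  -- integers is read off from kp/q unless q divides k.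
  have hsmall : |(k : ℝ)| * |q * α - p| ≤ 1 / 2 := by
    calc |(k : ℝ)| * |q * α - p| ≤ |(k : ℝ)| * (1 / q') := by gcongr
      _ ≤ 1 / 2 := by rw [mul_one_div, div_le_div_iff₀ hqR' two_pos]; linarith
  split_ifs with hdvd
  · obtain ⟨m, rfl⟩ := hdvd
    have hm0 : m ≠ 0 := by rintro rfl; simp at hk0
    have hm1 : (1 : ℝ) ≤ |(m : ℝ)| := by exact_mod_cast Int.one_le_abs hm0
    have := le_norm_unitExp_sub_one (x := (((q : ℤ) * m : ℤ) : ℝ) * α) (c := 1 / (2 * q')) (by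
      intro l
      have h1 : (((q : ℤ) * m : ℤ) : ℝ) * α - l = m * (q * α - p) - ((l - m * p : ℤ) : ℝ) := by
        push_cast; ring
      rw [h1]
      by_cases hl : l - m * p = 0
      · rw [hl, Int.cast_zero, sub_zero, abs_mul]
        exact hlow.trans (le_mul_of_one_le_left (abs_nonneg _) hm1)
      · have h2 : (1 : ℝ) ≤ |((l - m * p : ℤ) : ℝ)| := by exact_mod_cast Int.one_le_abs hl
        have h3 : |(m : ℝ) * (q * α - p)| ≤ 1 / 2 := by
          refine le_trans ?_ hsmall
          push_cast
          rw [abs_mul, abs_mul, abs_of_pos hqR]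
          exact mul_le_mul_of_nonneg_right (le_mul_of_one_le_left (abs_nonneg _) hq1) (abs_nonneg _)
        have h4 := abs_sub_abs_le_abs_sub ((l - m * p : ℤ) : ℝ) ((m : ℝ) * (q * α - p))
        rw [abs_sub_comm] at h4
        have h5 : 1 / (2 * (q' : ℝ)) ≤ 1 / 2 := by
          apply one_div_le_one_div_of_le <;> linarith
        linarith)
    refine le_trans (le_of_eq ?_) this
    field_simp; norm_num
  · have := le_norm_unitExp_sub_one (x := k * α) (c := 1 / (2 * q)) (by
      intro l
      have hne : k * p - l * q ≠ 0 := by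
        intro h0
        exact hdvd (hcop.symm.dvd_of_dvd_mul_right ⟨l, by linarith⟩)
      have h1 : (1 : ℝ) ≤ |((k * p - l * q : ℤ) : ℝ)| := by exact_mod_cast Int.one_le_abs hne
      have h2 : (q : ℝ) * (k * α - l) = k * (q * α - p) + ((k * p - l * q : ℤ) : ℝ) := by
        push_cast; ring
      have h3 : 1 / 2 ≤ (q : ℝ) * |k * α - l| := by
        have h4 := abs_sub_abs_le_abs_sub ((k * p - l * q : ℤ) : ℝ) (-(k * (q * α - p)))
        rw [abs_neg, abs_mul, sub_neg_eq_add, add_comm _ ((k : ℝ) * _), ← h2, abs_mul,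
          abs_of_pos hqR] at h4
        linarith
      rw [div_le_iff₀ (by positivity)]
      linarith)
    refine le_trans (le_of_eq ?_) this
    field_simp; norm_num
end

/-! ### Exponential, logarithm and Laurent series in a Banach algebra. -/

section
open Filter Topology

section BanachAlgebra
set_option linter.unusedSectionVars false
variable {𝔸 : Type*} [NormedRing 𝔸] [NormedAlgebra ℂ 𝔸] [CompleteSpace 𝔸]

theorem exp_add_of_commute_complex {x y : 𝔸} (h : Commute x y) :
    NormedSpace.exp (x + y) = NormedSpace.exp x * NormedSpace.exp y := by
  let _ : NormedAlgebra ℚ 𝔸 := NormedAlgebra.restrictScalars ℚ ℂ 𝔸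
  exact NormedSpace.exp_add_of_commute h

theorem exp_neg_mul_exp (x : 𝔸) : NormedSpace.exp (-x) * NormedSpace.exp x = 1 := by
  rw [← exp_add_of_commute_complex (Commute.refl x).neg_left, neg_add_cancel, NormedSpace.exp_zero]

theorem exp_mul_exp_neg (x : 𝔸) : NormedSpace.exp x * NormedSpace.exp (-x) = 1 := by
  rw [← exp_add_of_commute_complex (Commute.refl x).neg_right, add_neg_cancel, NormedSpace.exp_zero]

theorem mul_exp_of_semiconj (T : 𝔸ˣ) {x y : 𝔸} (h : T * x = y * T) :
    T * NormedSpace.exp x = NormedSpace.exp y * T := by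
  let _ : NormedAlgebra ℚ 𝔸 := NormedAlgebra.restrictScalars ℚ ℂ 𝔸
  have hy : y = T * x * ↑T⁻¹ := by rw [h, mul_assoc, Units.mul_inv, mul_one]
  rw [hy, NormedSpace.exp_units_conj, mul_assoc, Units.inv_mul, mul_one]

theorem norm_exp_sub_one_le (x : 𝔸) : ‖NormedSpace.exp x - 1‖ ≤ ‖x‖ * Real.exp ‖x‖ := by
  have h1 := NormedSpace.exp_series_hasSum_exp' (𝕂 := ℂ) x
  have h2 := (hasSum_nat_add_iff' 1).mpr h1
  simp only [Finset.range_one, Finset.sum_singleton, Nat.factorial_zero, Nat.cast_one, inv_one,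
    pow_zero, one_smul] at h2
  have h3 : HasSum (fun n : ℕ => ‖x‖ * ((n.factorial : ℝ)⁻¹ • ‖x‖ ^ n)) (‖x‖ * Real.exp ‖x‖) := by
    have := NormedSpace.exp_series_hasSum_exp' (𝕂 := ℝ) ‖x‖
    rw [← Real.exp_eq_exp_ℝ] at this
    exact this.mul_left _
  rw [← h2.tsum_eq]
  refine tsum_of_norm_bounded h3 fun n => ?_
  rw [norm_smul, norm_inv, RCLike.norm_natCast, smul_eq_mul]
  calc ((n + 1).factorial : ℝ)⁻¹ * ‖x ^ (n + 1)‖ ≤ (n.factorial : ℝ)⁻¹ * ‖x‖ ^ (n + 1) := by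
        gcongr
        · omega
        · exact norm_pow_le' _ (Nat.succ_pos n)
    _ = ‖x‖ * ((n.factorial : ℝ)⁻¹ * ‖x‖ ^ n) := by ring

/-- The series `-log (1 - x)`. -/
noncomputable def negLogOneSub (x : 𝔸) : 𝔸 := ∑' k : ℕ, ((k : ℂ) + 1)⁻¹ • x ^ (k + 1)

theorem hasSum_negLogOneSub {x : 𝔸} (hx : ‖x‖ < 1) :
    HasSum (fun k : ℕ => ((k : ℂ) + 1)⁻¹ • x ^ (k + 1)) (negLogOneSub x) := by
  refine Summable.hasSum (Summable.of_norm_bounded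
    ((summable_geometric_of_lt_one (norm_nonneg x) hx).mul_left ‖x‖) fun k => ?_)
  rw [norm_smul, norm_inv]
  have h1 : ‖((k : ℂ) + 1)‖ = (k : ℝ) + 1 := by
    have : ((k : ℂ) + 1) = ((k + 1 : ℕ) : ℂ) := by push_cast; rfl
    rw [this, RCLike.norm_natCast]; push_cast; rfl
  have h2 : ((k : ℝ) + 1)⁻¹ ≤ 1 := inv_le_one_of_one_le₀ (by linarith [Nat.cast_nonneg (α := ℝ) k])
  rw [h1]
  calc ((k : ℝ) + 1)⁻¹ * ‖x ^ (k + 1)‖ ≤ 1 * ‖x‖ ^ (k + 1) := by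
        gcongr
        exact norm_pow_le' _ (Nat.succ_pos k)
    _ = ‖x‖ * ‖x‖ ^ k := by ring

/-- With L(t) = -log(1 - tx), the function exp(L(t))(1 - tx) has zero derivative on a disc of radius
R > 1 and equals 1 at t = 0. -/
theorem exp_negLogOneSub_mul {x : 𝔸} (hx : ‖x‖ < 1) :
    NormedSpace.exp (negLogOneSub x) * (1 - x) = 1 := by
  obtain ⟨R, hR1, hRx⟩ : ∃ R : ℝ, 1 < R ∧ R * ‖x‖ < 1 := by
    have h1 : ∀ᶠ R : ℝ in 𝓝[>] 1, R * ‖x‖ < 1 := by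
      have : Tendsto (fun R : ℝ => R * ‖x‖) (𝓝[>] 1) (𝓝 (1 * ‖x‖)) :=
        ((continuous_mul_const ‖x‖).tendsto 1).mono_left nhdsWithin_le_nhds
      exact this.eventually_lt_const (by simpa using hx)
    obtain ⟨R, h2, h3⟩ := (h1.and self_mem_nhdsWithin).exists
    exact ⟨R, h3, h2⟩
  have hR0 : 0 < R := by linarith
  let L : ℂ → 𝔸 := fun t => ∑' k : ℕ, (t ^ (k + 1) * ((k : ℂ) + 1)⁻¹) • x ^ (k + 1)
  have hcomm : ∀ s t, Commute (L s) (L t) := fun s t =>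
    Commute.tsum_right _ fun _ => Commute.tsum_left _ fun _ =>
      (((Commute.refl x).pow_pow _ _).smul_left _).smul_right _
  have hnorm : ∀ t ∈ Metric.ball (0 : ℂ) R, ‖t • x‖ < 1 := by
    intro t ht
    have ht' : ‖t‖ < R := by simpa using ht
    rw [norm_smul]
    exact (mul_le_mul_of_nonneg_right ht'.le (norm_nonneg x)).trans_lt hRx
  have hL : ∀ t ∈ Metric.ball (0 : ℂ) R, HasDerivAt L (∑' k : ℕ, t ^ k • x ^ (k + 1)) t := by
    intro t ht
    refine hasDerivAt_tsum_of_isPreconnected (F := 𝔸) (t := Metric.ball (0 : ℂ) R)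
      (g := fun (k : ℕ) (t : ℂ) => (t ^ (k + 1) * ((k : ℂ) + 1)⁻¹) • x ^ (k + 1))
      (g' := fun (k : ℕ) (t : ℂ) => t ^ k • x ^ (k + 1)) (u := fun k => ‖x‖ * (R * ‖x‖) ^ k)
      ((summable_geometric_of_lt_one (by positivity) hRx).mul_left _) Metric.isOpen_ball
      (convex_ball (0 : ℂ) R).isPreconnected (fun k y _ => ?_) (fun k y hy => ?_)
      (Metric.mem_ball_self hR0) ?_ ht
    · have hk : ((k : ℂ) + 1) ≠ 0 := Nat.cast_add_one_ne_zero k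
      have h1 := ((hasDerivAt_pow (k + 1) y).mul_const ((k : ℂ) + 1)⁻¹).smul_const (x ^ (k + 1))
      convert h1 using 2
      push_cast
      field_simp
    · have hy' : ‖y‖ ≤ R := by simpa using (Metric.ball_subset_closedBall hy)
      rw [norm_smul, norm_pow, mul_pow]
      calc ‖y‖ ^ k * ‖x ^ (k + 1)‖ ≤ R ^ k * ‖x‖ ^ (k + 1) := by
            gcongr
            exact norm_pow_le' _ (Nat.succ_pos k)
        _ = ‖x‖ * (R ^ k * ‖x‖ ^ k) := by ring
    · simp only [zero_pow (Nat.succ_ne_zero _), zero_mul, zero_smul]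
      exact summable_zero
  have hLx : ∀ t ∈ Metric.ball (0 : ℂ) R, (∑' k : ℕ, t ^ k • x ^ (k + 1)) * (1 - t • x) = x := by
    intro t ht
    have h1 : ∑' k : ℕ, t ^ k • x ^ (k + 1) = x * ∑' k : ℕ, (t • x) ^ k := by
      rw [← (summable_geometric_of_norm_lt_one (hnorm t ht)).tsum_mul_left]
      refine tsum_congr fun k => ?_
      rw [smul_pow, mul_smul_comm, pow_succ']
    rw [h1, mul_assoc, geom_series_mul_neg _ (hnorm t ht), mul_one]
  let Y : ℂ → 𝔸 := fun t => NormedSpace.exp (L t) * (1 - t • x)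
  have hY : ∀ t ∈ Metric.ball (0 : ℂ) R, HasDerivAt Y 0 t := by
    intro t ht
    -- All L(s) commute, so splitting off exp(L t) reduces the derivative of exp to its derivative
    -- at 0.
    have hexp : HasDerivAt (fun s => NormedSpace.exp (L s - L t)) (∑' k : ℕ, t ^ k • x ^ (k + 1)) t := by
      have h0 : HasFDerivAt (NormedSpace.exp : 𝔸 → 𝔸) (1 : 𝔸 →L[ℂ] 𝔸) (L t - L t) := by
        rw [sub_self]; exact hasFDerivAt_exp_zero
      exact h0.comp_hasDerivAt t ((hL t ht).sub_const (L t))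
    have hfac : Y = fun s => NormedSpace.exp (L t) * (NormedSpace.exp (L s - L t) * (1 - s • x)) := by
      funext s
      simp only [Y]
      rw [← mul_assoc, ← exp_add_of_commute_complex (((hcomm t s).sub_right (Commute.refl _))),
        add_sub_cancel]
    rw [hfac]
    have hlin : HasDerivAt (fun s : ℂ => 1 - s • x) (-x) t := by
      have := ((hasDerivAt_id t).smul_const x).const_sub 1
      simpa using this
    have := (hexp.mul hlin).const_mul (NormedSpace.exp (L t))
    rw [hLx t ht, sub_self, NormedSpace.exp_zero, one_mul, add_neg_cancel, mul_zero] at this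
    exact this
  have hconst := Metric.isOpen_ball.is_const_of_deriv_eq_zero (convex_ball (0 : ℂ) R).isPreconnected
    (fun t ht => (hY t ht).differentiableAt.differentiableWithinAt)
    (fun t ht => (hY t ht).deriv) (x := 1) (y := 0) (by simpa using hR1) (Metric.mem_ball_self hR0)
  have h0 : Y 0 = 1 := by
    have : L 0 = 0 := by
      simp only [L, zero_pow (Nat.succ_ne_zero _), zero_mul, zero_smul, tsum_zero]
    simp only [Y, this, NormedSpace.exp_zero, zero_smul, sub_zero, mul_one]
  have h1 : Y 1 = NormedSpace.exp (negLogOneSub x) * (1 - x) := by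
    simp only [Y, L, negLogOneSub, one_pow, one_mul, one_smul]
  rw [← h1, hconst, h0]

theorem commute_negLogOneSub {x y : 𝔸} (h : Commute x y) :
    Commute (negLogOneSub x) (negLogOneSub y) :=
  Commute.tsum_right _ fun _ => Commute.tsum_left _ fun _ =>
    ((h.pow_pow _ _).smul_left _).smul_right _

theorem one_sub_eq_exp {x : 𝔸} (hx : ‖x‖ < 1) : 1 - x = NormedSpace.exp (-negLogOneSub x) := by
  have h := exp_negLogOneSub_mul hx
  calc 1 - x = (NormedSpace.exp (-negLogOneSub x) * NormedSpace.exp (negLogOneSub x)) * (1 - x) := by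
        rw [exp_neg_mul_exp, one_mul]
    _ = _ := by rw [mul_assoc, h, mul_one]

/-- The Laurent series with coefficients `d` evaluated at a unit. -/
noncomputable def laurentEval (S : 𝔸ˣ) (d : ℤ → ℂ) : 𝔸 := ∑' k : ℤ, d k • ((S ^ k : 𝔸ˣ) : 𝔸)

variable {S : 𝔸ˣ} {R : ℝ}

theorem norm_smul_zpow_le (hS : ∀ k : ℤ, ‖((S ^ k : 𝔸ˣ) : 𝔸)‖ ≤ R ^ k.natAbs) (d : ℤ → ℂ) (k : ℤ) :
    ‖d k • ((S ^ k : 𝔸ˣ) : 𝔸)‖ ≤ ‖d k‖ * R ^ k.natAbs := by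
  rw [norm_smul]
  exact mul_le_mul_of_nonneg_left (hS k) (norm_nonneg _)

theorem hasSum_laurentEval (hS : ∀ k : ℤ, ‖((S ^ k : 𝔸ˣ) : 𝔸)‖ ≤ R ^ k.natAbs) {d : ℤ → ℂ}
    (hd : Summable fun k => ‖d k‖ * R ^ k.natAbs) :
    HasSum (fun k : ℤ => d k • ((S ^ k : 𝔸ˣ) : 𝔸)) (laurentEval S d) :=
  (Summable.of_norm_bounded hd (norm_smul_zpow_le hS d)).hasSum

theorem norm_laurentEval_le (hS : ∀ k : ℤ, ‖((S ^ k : 𝔸ˣ) : 𝔸)‖ ≤ R ^ k.natAbs) {d : ℤ → ℂ}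
    {a : ℤ → ℝ} (ha : Summable a) (hd : ∀ k, ‖d k‖ * R ^ k.natAbs ≤ a k) :
    ‖laurentEval S d‖ ≤ ∑' k, a k :=
  tsum_of_norm_bounded ha.hasSum fun k => (norm_smul_zpow_le hS d k).trans (hd k)

theorem laurentEval_add (hS : ∀ k : ℤ, ‖((S ^ k : 𝔸ˣ) : 𝔸)‖ ≤ R ^ k.natAbs) {d d' : ℤ → ℂ}
    (hd : Summable fun k => ‖d k‖ * R ^ k.natAbs) (hd' : Summable fun k => ‖d' k‖ * R ^ k.natAbs) :
    laurentEval S (fun k => d k + d' k) = laurentEval S d + laurentEval S d' := by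
  rw [← ((hasSum_laurentEval hS hd).add (hasSum_laurentEval hS hd')).tsum_eq, laurentEval]
  simp only [add_smul]

theorem commute_laurentEval (S : 𝔸ˣ) (d d' : ℤ → ℂ) : Commute (laurentEval S d) (laurentEval S d') :=
  Commute.tsum_right _ fun _ => Commute.tsum_left _ fun _ =>
    (((((Commute.refl S).zpow_zpow _ _).units_val)).smul_left _).smul_right _

theorem mul_zpow_of_mul_eq {T : 𝔸ˣ} {ζ : ℂ} (hζ : ζ ≠ 0)
    (hTS : (T : 𝔸) * S = ζ • ((S : 𝔸) * T)) (k : ℤ) :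
    (T : 𝔸) * ((S ^ k : 𝔸ˣ) : 𝔸) = ζ ^ k • (((S ^ k : 𝔸ˣ) : 𝔸) * T) := by
  have hinv : (T : 𝔸) * ((S⁻¹ : 𝔸ˣ) : 𝔸) = ζ⁻¹ • (((S⁻¹ : 𝔸ˣ) : 𝔸) * T) := by
    have h1 : ((S⁻¹ : 𝔸ˣ) : 𝔸) * ((T : 𝔸) * S) * ((S⁻¹ : 𝔸ˣ) : 𝔸) = ζ • (T * ((S⁻¹ : 𝔸ˣ) : 𝔸)) := by
      rw [hTS, mul_smul_comm, smul_mul_assoc, ← mul_assoc, Units.inv_mul, one_mul]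
    rw [mul_assoc, mul_assoc, Units.mul_inv, mul_one] at h1
    rw [h1, smul_smul, inv_mul_cancel₀ hζ, one_smul]
  induction k with
  | zero => simp
  | succ n ih =>
    rw [zpow_add_one, Units.val_mul, ← mul_assoc, ih, smul_mul_assoc, mul_assoc, hTS,
      mul_smul_comm, smul_smul, zpow_add_one₀ hζ, mul_assoc]
  | pred n ih =>
    rw [zpow_sub_one, Units.val_mul, ← mul_assoc, ih, smul_mul_assoc, mul_assoc, hinv,
      mul_smul_comm, smul_smul, zpow_sub_one₀ hζ, mul_assoc]

/-- Moving T across a function of S rotates the variable, f(z) ↦ f(ζz), which multiplies the k-th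
coefficient by ζ^k. -/
theorem mul_laurentEval (hS : ∀ k : ℤ, ‖((S ^ k : 𝔸ˣ) : 𝔸)‖ ≤ R ^ k.natAbs) {T : 𝔸ˣ} {ζ : ℂ}
    (hζ : ‖ζ‖ = 1) (hTS : (T : 𝔸) * S = ζ • ((S : 𝔸) * T)) {d : ℤ → ℂ}
    (hd : Summable fun k => ‖d k‖ * R ^ k.natAbs) :
    (T : 𝔸) * laurentEval S d = laurentEval S (fun k => ζ ^ k * d k) * T := by
  have hζ0 : ζ ≠ 0 := by rintro rfl; simp at hζ
  have hd' : Summable fun k => ‖ζ ^ k * d k‖ * R ^ k.natAbs := by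
    simpa [norm_mul, norm_zpow, hζ] using hd
  have h1 := (hasSum_laurentEval hS hd).mul_left (T : 𝔸)
  have h2 := (hasSum_laurentEval hS hd').mul_right (T : 𝔸)
  refine h1.unique ?_
  convert h2 using 2 with k
  rw [mul_smul_comm, mul_zpow_of_mul_eq hζ0 hTS, smul_smul, smul_mul_assoc, mul_comm]

/-- Laurent coefficients of the logarithm of
`(1 - b z)(1 - b z⁻¹) / ((1 - conj b z)(1 - conj b z⁻¹))`. -/
noncomputable def symbolCoeff (b : ℂ) (k : ℤ) : ℂ :=
  ((starRingEnd ℂ) b ^ k.natAbs - b ^ k.natAbs) / k.natAbs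

/-- Positive powers of S give log(1 - bS) - log(1 - b̄S), and negative powers give the same in S⁻¹.
All these logarithms commute, so exponentials multiply. -/
theorem exp_laurentEval_symbolCoeff (hS : ∀ k : ℤ, ‖((S ^ k : 𝔸ˣ) : 𝔸)‖ ≤ R ^ k.natAbs) {b : ℂ}
    (hb : ‖b‖ * R < 1) :
    NormedSpace.exp (laurentEval S (symbolCoeff b)) *
      ((1 - (starRingEnd ℂ) b • (S : 𝔸)) * (1 - (starRingEnd ℂ) b • ((S⁻¹ : 𝔸ˣ) : 𝔸))) =
      (1 - b • (S : 𝔸)) * (1 - b • ((S⁻¹ : 𝔸ˣ) : 𝔸)) := by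
  have hS1 : ‖(S : 𝔸)‖ ≤ R := by simpa using hS 1
  have hS2 : ‖((S⁻¹ : 𝔸ˣ) : 𝔸)‖ ≤ R := by simpa using hS (-1)
  have hlt : ∀ c : ℂ, ‖c‖ = ‖b‖ → ‖c • (S : 𝔸)‖ < 1 ∧ ‖c • ((S⁻¹ : 𝔸ˣ) : 𝔸)‖ < 1 := by
    intro c hc
    rw [norm_smul, norm_smul, hc]
    exact ⟨(mul_le_mul_of_nonneg_left hS1 (norm_nonneg b)).trans_lt hb,
      (mul_le_mul_of_nonneg_left hS2 (norm_nonneg b)).trans_lt hb⟩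
  set b' := (starRingEnd ℂ) b with hb'
  have hbn : ‖b'‖ = ‖b‖ := RCLike.norm_conj b
  set u := negLogOneSub (b • (S : 𝔸)) with hu
  set v := negLogOneSub (b • ((S⁻¹ : 𝔸ˣ) : 𝔸)) with hv
  set u' := negLogOneSub (b' • (S : 𝔸)) with hu'
  set v' := negLogOneSub (b' • ((S⁻¹ : 𝔸ˣ) : 𝔸)) with hv'
  have hSS : Commute (S : 𝔸) ((S⁻¹ : 𝔸ˣ) : 𝔸) := (Commute.refl S).inv_right.units_val
  have c1 : ∀ c c' : ℂ, Commute (negLogOneSub (c • (S : 𝔸))) (negLogOneSub (c' • (S : 𝔸))) :=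
    fun c c' => commute_negLogOneSub (((Commute.refl _).smul_left c).smul_right c')
  have c2 : ∀ c c' : ℂ, Commute (negLogOneSub (c • (S : 𝔸)))
      (negLogOneSub (c' • ((S⁻¹ : 𝔸ˣ) : 𝔸))) :=
    fun c c' => commute_negLogOneSub ((hSS.smul_left c).smul_right c')
  have c3 : ∀ c c' : ℂ, Commute (negLogOneSub (c • ((S⁻¹ : 𝔸ˣ) : 𝔸)))
      (negLogOneSub (c' • ((S⁻¹ : 𝔸ˣ) : 𝔸))) :=
    fun c c' => commute_negLogOneSub (((Commute.refl _).smul_left c).smul_right c')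
  have hsum : laurentEval S (symbolCoeff b) = (u' - u) + (v' - v) := by
    refine HasSum.tsum_eq ?_
    refine HasSum.of_nat_of_neg_add_one ?_ ?_
    · rw [← hasSum_nat_add_iff' 1]
      -- The coefficient at k = 0 is (1 - 1)/0 = 0: Φ has mean zero, so the cohomological equation
      -- has no obstruction there.
      have h0 : (u' - u) - ∑ i ∈ Finset.range 1, symbolCoeff b ((i : ℕ) : ℤ) • ((S ^ ((i : ℕ) : ℤ) : 𝔸ˣ) : 𝔸)
          = u' - u := by
        simp [symbolCoeff]
      rw [h0]
      refine ((hasSum_negLogOneSub (hlt b' hbn).1).sub (hasSum_negLogOneSub (hlt b rfl).1)).congr_fun ?_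
      intro k
      simp only [symbolCoeff, Int.natAbs_natCast, zpow_natCast, Units.val_pow_eq_pow_val, smul_pow,
        smul_smul, ← sub_smul]
      congr 1
      push_cast
      rw [div_eq_inv_mul, mul_sub]
    · refine ((hasSum_negLogOneSub (hlt b' hbn).2).sub (hasSum_negLogOneSub (hlt b rfl).2)).congr_fun ?_
      intro k
      have hk : (-((k : ℤ) + 1)).natAbs = k + 1 := by omega
      have hz : (S ^ (-((k : ℤ) + 1)) : 𝔸ˣ) = S⁻¹ ^ (k + 1) := by
        rw [zpow_neg, ← inv_zpow]
        exact zpow_natCast _ (k + 1)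
      simp only [symbolCoeff, hk, hz, Units.val_pow_eq_pow_val, smul_pow, smul_smul, ← sub_smul]
      congr 1
      push_cast
      rw [div_eq_inv_mul, mul_sub]
  rw [hsum, one_sub_eq_exp (hlt b' hbn).1, one_sub_eq_exp (hlt b' hbn).2,
    one_sub_eq_exp (hlt b rfl).1, one_sub_eq_exp (hlt b rfl).2]
  rw [← exp_add_of_commute_complex ((c2 b' b').neg_left.neg_right),
    ← exp_add_of_commute_complex ((c2 b b).neg_left.neg_right), ← exp_add_of_commute_complex]
  · congr 1; abel
  · have d1 : Commute (u' - u) (-u') := ((c1 b' b').sub_left (c1 b b')).neg_right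
    have d2 : Commute (u' - u) (-v') := ((c2 b' b').sub_left (c2 b b')).neg_right
    have d3 : Commute (v' - v) (-u') := ((c2 b' b').symm.sub_left (c2 b' b).symm).neg_right
    have d4 : Commute (v' - v) (-v') := ((c3 b' b').sub_left (c3 b b')).neg_right
    exact (d1.add_right d2).add_left (d3.add_right d4)

end BanachAlgebra
end

/-! ### Iterating the cocycle equation Tv = c exp(Φ)v. -/

section
open Filter Topology

theorem summable_pow_natAbs {r : ℝ} (h0 : 0 ≤ r) (h1 : r < 1) :
    Summable fun k : ℤ => r ^ k.natAbs := by
  refine Summable.of_nat_of_neg ?_ ?_ <;> simpa using summable_geometric_of_lt_one h0 h1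

theorem norm_pow_sub_one_le {w : ℂ} (hw : ‖w‖ = 1) (m : ℕ) : ‖w ^ m - 1‖ ≤ m * ‖w - 1‖ := by
  rw [← geom_sum_mul, norm_mul]
  refine mul_le_mul_of_nonneg_right ((norm_sum_le _ _).trans ?_) (norm_nonneg _)
  simp [hw]

theorem norm_conj_div_self {b : ℂ} (hb : b ≠ 0) : ‖(starRingEnd ℂ) b / b‖ = 1 := by
  rw [norm_div, RCLike.norm_conj, div_self (norm_ne_zero_iff.mpr hb)]

theorem norm_symbolCoeff_mul_le (b : ℂ) (k : ℤ) :
    ‖symbolCoeff b k‖ * |(k : ℝ)| ≤ 2 * ‖b‖ ^ k.natAbs := by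
  have h1 : ‖(starRingEnd ℂ) b ^ k.natAbs - b ^ k.natAbs‖ ≤ 2 * ‖b‖ ^ k.natAbs := by
    refine (norm_sub_le _ _).trans (le_of_eq ?_)
    rw [norm_pow, norm_pow, RCLike.norm_conj]; ring
  rw [symbolCoeff, norm_div, RCLike.norm_natCast, Nat.cast_natAbs, Int.cast_abs]
  rcases eq_or_ne k 0 with rfl | hk
  · simp
  · rwa [div_mul_cancel₀ _ (abs_ne_zero.mpr (Int.cast_ne_zero.mpr hk))]

theorem norm_symbolCoeff_le (b : ℂ) (k : ℤ) : ‖symbolCoeff b k‖ ≤ 2 * ‖b‖ ^ k.natAbs := by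
  rcases eq_or_ne k 0 with rfl | hk
  · simp [symbolCoeff]
  · refine le_trans ?_ (norm_symbolCoeff_mul_le b k)
    exact le_mul_of_one_le_right (norm_nonneg _) (by exact_mod_cast Int.one_le_abs hk)

/-- Put w = b̄/b, which has modulus 1. For |k| = qm the numerator is b^|k| (w^{qm} - 1), and |w^{qm}
- 1| ≤ m|w^q - 1|; dividing by qm leaves 1/q. -/
theorem norm_symbolCoeff_le_of_dvd {b : ℂ} (hb : b ≠ 0) {q : ℕ} (hq : 0 < q) {k : ℤ} (hk : k ≠ 0)
    (hdvd : (q : ℤ) ∣ k) :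
    ‖symbolCoeff b k‖ ≤ ‖b‖ ^ k.natAbs * ‖((starRingEnd ℂ) b / b) ^ q - 1‖ / q := by
  obtain ⟨m, hm⟩ : q ∣ k.natAbs := Int.natCast_dvd.mp hdvd
  have hm0 : 0 < m := by
    rcases Nat.eq_zero_or_pos m with rfl | h
    · simp at hm; exact absurd hm hk
    · exact h
  have h1 : (starRingEnd ℂ) b ^ k.natAbs - b ^ k.natAbs =
      b ^ k.natAbs * ((((starRingEnd ℂ) b / b) ^ q) ^ m - 1) := by
    rw [← pow_mul, ← hm, div_pow, mul_sub, mul_one, mul_div_cancel₀ _ (pow_ne_zero _ hb)]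
  have h2 := norm_pow_sub_one_le (w := ((starRingEnd ℂ) b / b) ^ q)
    (by rw [norm_pow, norm_conj_div_self hb, one_pow]) m
  have hmR : (0 : ℝ) < m := by exact_mod_cast hm0
  have hqR : (0 : ℝ) < q := by exact_mod_cast hq
  rw [symbolCoeff, h1, norm_div, norm_mul, norm_pow, RCLike.norm_natCast]
  rw [show ((k.natAbs : ℕ) : ℝ) = q * m by rw [hm]; push_cast; ring]
  rw [div_le_div_iff₀ (by positivity) hqR]
  calc ‖b‖ ^ k.natAbs * ‖(((starRingEnd ℂ) b / b) ^ q) ^ m - 1‖ * q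
      ≤ ‖b‖ ^ k.natAbs * (m * ‖((starRingEnd ℂ) b / b) ^ q - 1‖) * q := by gcongr
    _ = _ := by ring

section Cocycle
variable {X : Type*} [NormedAddCommGroup X] [NormedSpace ℂ X] [CompleteSpace X]
  {S T : (X →L[ℂ] X)ˣ} {R α : ℝ} {b c : ℂ} {v : X}

theorem summable_symbolCoeff (hR : 0 ≤ R) (hb : ‖b‖ * R < 1) :
    Summable fun k => ‖symbolCoeff b k‖ * R ^ k.natAbs := by
  refine Summable.of_nonneg_of_le (fun k => by positivity) (fun k => ?_)
    ((summable_pow_natAbs (mul_nonneg (norm_nonneg b) hR) hb).mul_left 2)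
  calc ‖symbolCoeff b k‖ * R ^ k.natAbs ≤ 2 * ‖b‖ ^ k.natAbs * R ^ k.natAbs := by
        gcongr
        exact norm_symbolCoeff_le b k
    _ = 2 * (‖b‖ * R) ^ k.natAbs := by rw [mul_pow]; ring

theorem norm_sum_unitExp_le (x : ℝ) (N : ℕ) : ‖∑ j ∈ Finset.range N, unitExp (j * x)‖ ≤ N := by
  refine (norm_sum_le _ _).trans ?_
  simp [norm_unitExp]

/-- Iterating the relation `T v = c exp(Φ) v`. -/
theorem pow_apply_eq_of_apply_eq (hR : 0 ≤ R)
    (hS : ∀ k : ℤ, ‖((S ^ k : (X →L[ℂ] X)ˣ) : X →L[ℂ] X)‖ ≤ R ^ k.natAbs)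
    (hTS : (T : X →L[ℂ] X) * S = unitExp α • ((S : X →L[ℂ] X) * T)) (hb : ‖b‖ * R < 1)
    (hv : (T : X →L[ℂ] X) v = c • NormedSpace.exp (laurentEval S (symbolCoeff b)) v) (N : ℕ) :
    ((T : X →L[ℂ] X) ^ N) v = c ^ N • NormedSpace.exp (laurentEval S fun k =>
      (∑ j ∈ Finset.range N, unitExp (j * (k * α))) * symbolCoeff b k) v := by
  have hd := summable_symbolCoeff hR hb
  have hζ := norm_unitExp α
  have hdN : ∀ N : ℕ, Summable fun k : ℤ =>
      ‖(∑ j ∈ Finset.range N, unitExp (j * (k * α))) * symbolCoeff b k‖ * R ^ k.natAbs := by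
    intro N
    refine Summable.of_nonneg_of_le (fun k => by positivity) (fun k => ?_) (hd.mul_left (N : ℝ))
    rw [norm_mul, ← mul_assoc]
    gcongr
    exact norm_sum_unitExp_le _ _
  induction N with
  | zero => simp [laurentEval]
  | succ N ih =>
    set A := laurentEval S fun k : ℤ =>
      (∑ j ∈ Finset.range N, unitExp (j * (k * α))) * symbolCoeff b k with hA
    have hshift := mul_laurentEval hS hζ hTS (hdN N)
    have hsh : Summable fun k : ℤ => ‖unitExp α ^ k *
        ((∑ j ∈ Finset.range N, unitExp (j * (k * α))) * symbolCoeff b k)‖ * R ^ k.natAbs := by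
      simpa [norm_mul, norm_zpow, hζ] using hdN N
    set A' := laurentEval S fun k : ℤ =>
      unitExp α ^ k * ((∑ j ∈ Finset.range N, unitExp (j * (k * α))) * symbolCoeff b k) with hA'
    have hexp := mul_exp_of_semiconj T hshift
    -- Moving T across the exponential shifts every index of the sum by one; the missing j = 0 term
    -- is the Φ supplied by Tv.
    have hsum : laurentEval S (fun k : ℤ =>
        (∑ j ∈ Finset.range (N + 1), unitExp (j * (k * α))) * symbolCoeff b k)
        = A' + laurentEval S (symbolCoeff b) := by
      rw [hA', ← laurentEval_add hS hsh hd]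
      congr 1
      funext k
      rw [Finset.sum_range_succ', Nat.cast_zero, zero_mul, ← mul_assoc, Finset.mul_sum, add_mul]
      congr 1
      · congr 1
        refine Finset.sum_congr rfl fun j _ => ?_
        rw [← unitExp_intCast_mul, ← unitExp_add]
        congr 1; push_cast; ring
      · simp [unitExp]
    have hcomm : Commute A' (laurentEval S (symbolCoeff b)) := commute_laurentEval S _ _
    rw [hsum, exp_add_of_commute_complex hcomm, pow_succ', mul_apply_eq_comp, ih,
      map_smul, ← mul_apply_eq_comp, hexp, mul_apply_eq_comp, hv, map_smul,
      smul_smul, pow_succ, mul_apply_eq_comp]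

/-- The phase of the cocycle is nearly resonant at denominators of good rational approximations. -/
theorem exists_norm_pow_sub_one_le (hR : 1 ≤ R)
    (hS : ∀ k : ℤ, ‖((S ^ k : (X →L[ℂ] X)ˣ) : X →L[ℂ] X)‖ ≤ R ^ k.natAbs)
    (hTS : (T : X →L[ℂ] X) * S = unitExp α • ((S : X →L[ℂ] X) * T)) (hb0 : b ≠ 0)
    (hb : ‖b‖ * R < 1) (hc : ‖c‖ = 1) (hv0 : v ≠ 0)
    (hv : (T : X →L[ℂ] X) v = c • NormedSpace.exp (laurentEval S (symbolCoeff b)) v)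
    {C₁ : ℝ} (hT : ∀ (N : ℕ) (p : ℤ), ‖((T : X →L[ℂ] X) ^ N) v - v‖ ≤ C₁ * |N * α - p|) :
    ∃ C σ : ℝ, 0 ≤ C ∧ 0 ≤ σ ∧ σ < 1 ∧ ∀ (q q' : ℕ) (p : ℤ), 0 < q → q ≤ q' →
      IsCoprime p (q : ℤ) → |q * α - p| ≤ 1 / q' →
      ‖c ^ q - 1‖ ≤ C * (q / q' + ‖((starRingEnd ℂ) b / b) ^ q - 1‖ * σ ^ q) := by
  have hR0 : 0 ≤ R := by linarith
  set ρ := ‖b‖ * R with hρ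
  have hρ0 : 0 ≤ ρ := by positivity
  -- The decay ρ^|k| is split into two equal halves: one for summability in k, one for the gain σ^q,
  -- available because nonzero multiples of q have |k| ≥ q.
  set σ := Real.sqrt ρ with hσ
  have hσ0 : 0 ≤ σ := Real.sqrt_nonneg _
  have hσ1 : σ < 1 := by rw [hσ, Real.sqrt_lt' one_pos]; simpa using hb
  have hσρ : σ * σ = ρ := Real.mul_self_sqrt hρ0
  have hsumσ := summable_pow_natAbs hσ0 hσ1
  set K := ∑' k : ℤ, σ ^ k.natAbs with hK
  have hK0 : 0 ≤ K := tsum_nonneg fun k => by positivity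
  have hC₁ : 0 ≤ C₁ := by
    have h := hT 0 1
    simp at h
    exact h
  have hvpos : 0 < ‖v‖ := norm_pos_iff.mpr hv0
  set B := K * (4 * Real.pi + 2) with hB
  have hpi := Real.pi_pos
  have hB0 : 0 ≤ B := by positivity
  set D := Real.exp B * (K * (4 * Real.pi + 1)) with hD
  have hD0 : 0 ≤ D := by positivity
  refine ⟨C₁ / ‖v‖ + D, σ, by positivity, hσ0, hσ1, ?_⟩
  intro q q' p hq hqq' hcop happ
  have hqR : (0 : ℝ) < q := by exact_mod_cast hq
  have hq1 : (1 : ℝ) ≤ q := by exact_mod_cast hq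
  have hqqR : (q : ℝ) ≤ q' := by exact_mod_cast hqq'
  have hqR' : (0 : ℝ) < q' := by linarith
  set s := ‖((starRingEnd ℂ) b / b) ^ q - 1‖ with hs
  have hs0 : 0 ≤ s := norm_nonneg _
  have hs2 : s ≤ 2 := by
    refine (norm_sub_le _ _).trans ?_
    rw [norm_pow, norm_conj_div_self hb0, one_pow, norm_one]; norm_num
  set Φ := laurentEval S fun k : ℤ =>
      (∑ j ∈ Finset.range q, unitExp (j * (k * α))) * symbolCoeff b k with hΦ
  set ε := 4 * Real.pi * (q / q') + s * σ ^ q with hε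
  have hε0 : 0 ≤ ε := by positivity
  -- Off the multiples of q the exponential sum is O(q|k|/q'), and |k| cancels against the
  -- coefficient; on the multiples the extra main term q cancels against the 1/q of the resonant
  -- coefficient.
  have hΦle : ‖Φ‖ ≤ ε * K := by
    rw [hK, ← tsum_mul_left]
    refine norm_laurentEval_le hS (hsumσ.mul_left ε) fun k => ?_
    rcases eq_or_ne k 0 with rfl | hk
    · simp [symbolCoeff]; exact hε0
    have hρσ : ρ ^ k.natAbs ≤ σ ^ k.natAbs := by
      rw [← hσρ]
      exact pow_le_pow_left₀ (by positivity) (mul_le_of_le_one_left hσ0 hσ1.le) _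
    set e0 : ℂ := if (q : ℤ) ∣ k then (q : ℂ) else 0 with he0
    have hE := norm_sum_unitExp_sub_le hq hcop happ k
    have h1 : ‖∑ j ∈ Finset.range q, unitExp (j * (k * α))‖ ≤
        2 * Real.pi * q * |(k : ℝ)| / q' + ‖e0‖ := by
      have := norm_le_norm_add_norm_sub' (∑ j ∈ Finset.range q, unitExp (j * (k * α))) e0
      linarith
    have h2 : ‖e0‖ * ‖symbolCoeff b k‖ * R ^ k.natAbs ≤ s * σ ^ q * σ ^ k.natAbs := by
      rw [he0]
      split_ifs with hdvd
      · have h3 := norm_symbolCoeff_le_of_dvd hb0 hq hk hdvd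
        have hqk : q ≤ k.natAbs := Nat.le_of_dvd (Int.natAbs_pos.mpr hk) (Int.natCast_dvd.mp hdvd)
        rw [RCLike.norm_natCast]
        calc (q : ℝ) * ‖symbolCoeff b k‖ * R ^ k.natAbs
            ≤ q * (‖b‖ ^ k.natAbs * s / q) * R ^ k.natAbs := by gcongr
          _ = s * ρ ^ k.natAbs := by rw [hρ, mul_pow]; field_simp
          _ = s * (σ ^ k.natAbs * σ ^ k.natAbs) := by rw [← hσρ, mul_pow]
          _ ≤ s * (σ ^ q * σ ^ k.natAbs) := by
            gcongr ?_ * (?_ * ?_)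
            exact pow_le_pow_of_le_one hσ0 hσ1.le hqk
          _ = _ := by ring
      · simp; positivity
    rw [norm_mul]
    calc ‖∑ j ∈ Finset.range q, unitExp (j * (k * α))‖ * ‖symbolCoeff b k‖ * R ^ k.natAbs
        ≤ (2 * Real.pi * q * |(k : ℝ)| / q' + ‖e0‖) * ‖symbolCoeff b k‖ * R ^ k.natAbs := by gcongr
      _ = 2 * Real.pi * (q / q') * (‖symbolCoeff b k‖ * |(k : ℝ)|) * R ^ k.natAbs
          + ‖e0‖ * ‖symbolCoeff b k‖ * R ^ k.natAbs := by ring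
      _ ≤ 2 * Real.pi * (q / q') * (2 * ‖b‖ ^ k.natAbs) * R ^ k.natAbs
          + s * σ ^ q * σ ^ k.natAbs := by
            gcongr ?_ * ?_ * _ + ?_
            exact norm_symbolCoeff_mul_le b k
      _ = 4 * Real.pi * (q / q') * ρ ^ k.natAbs + s * σ ^ q * σ ^ k.natAbs := by
            rw [hρ, mul_pow]; ring
      _ ≤ 4 * Real.pi * (q / q') * σ ^ k.natAbs + s * σ ^ q * σ ^ k.natAbs := by gcongr
      _ = ε * σ ^ k.natAbs := by rw [hε]; ring
  have hr1 : (q : ℝ) / q' ≤ 1 := (div_le_one hqR').mpr hqqR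
  have hsσ : s * σ ^ q ≤ 2 := by
    calc s * σ ^ q ≤ 2 * 1 := by
          gcongr
          exact pow_le_one₀ hσ0 hσ1.le
      _ = 2 := by norm_num
  have hΦB : ‖Φ‖ ≤ B := by
    refine hΦle.trans ?_
    rw [hB, mul_comm]
    gcongr
    nlinarith
  have hexp : ‖NormedSpace.exp Φ - 1‖ ≤ D * (q / q' + s * σ ^ q) := by
    calc ‖NormedSpace.exp Φ - 1‖ ≤ ‖Φ‖ * Real.exp ‖Φ‖ := norm_exp_sub_one_le Φ
      _ ≤ (ε * K) * Real.exp B := by gcongr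
      _ ≤ ((4 * Real.pi + 1) * (q / q' + s * σ ^ q) * K) * Real.exp B := by
          gcongr
          have : 0 ≤ (q : ℝ) / q' := by positivity
          have : 0 ≤ s * σ ^ q := by positivity
          nlinarith
      _ = D * (q / q' + s * σ ^ q) := by rw [hD]; ring
  have hiter := pow_apply_eq_of_apply_eq hR0 hS hTS hb hv q
  -- With T^q v close to v and exp Φ close to 1, the relation T^q v = c^q exp(Φ) v leaves c^q close
  -- to 1.
  have hkey : (c ^ q - 1) • v = (((T : X →L[ℂ] X) ^ q) v - v) - c ^ q • (NormedSpace.exp Φ - 1) v := by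
    rw [hiter, sub_apply, one_apply_eq_self, sub_smul, smul_sub,
      one_smul]
    abel
  have hnorm : ‖c ^ q - 1‖ * ‖v‖ ≤ C₁ * (q / q') + D * (q / q' + s * σ ^ q) * ‖v‖ := by
    rw [← norm_smul, hkey]
    refine (norm_sub_le _ _).trans (add_le_add ?_ ?_)
    · refine (hT q p).trans (mul_le_mul_of_nonneg_left (happ.trans ?_) hC₁)
      gcongr
    · rw [norm_smul, norm_pow, hc, one_pow, one_mul]
      exact (ContinuousLinearMap.le_opNorm _ _).trans (mul_le_mul_of_nonneg_right hexp hvpos.le)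
  rw [← le_div_iff₀ hvpos] at hnorm
  refine hnorm.trans ?_
  have h5 : 0 ≤ s * σ ^ q := by positivity
  have h6 : 0 ≤ C₁ / ‖v‖ := by positivity
  have h7 : (C₁ * (q / q') + D * (q / q' + s * σ ^ q) * ‖v‖) / ‖v‖ =
      C₁ / ‖v‖ * (q / q') + D * (q / q' + s * σ ^ q) := by field_simp
  rw [h7]
  nlinarith [mul_nonneg h6 h5]

/-- A solution of the cohomological equation reduces the cocycle to a constant one. -/
theorem exists_eigenvector_of_cohomology (hR : 0 ≤ R)
    (hS : ∀ k : ℤ, ‖((S ^ k : (X →L[ℂ] X)ˣ) : X →L[ℂ] X)‖ ≤ R ^ k.natAbs)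
    (hTS : (T : X →L[ℂ] X) * S = unitExp α • ((S : X →L[ℂ] X) * T)) (hb : ‖b‖ * R < 1) (hv0 : v ≠ 0)
    (hv : (T : X →L[ℂ] X) v = c • NormedSpace.exp (laurentEval S (symbolCoeff b)) v)
    {φ : ℤ → ℂ} (hφ : Summable fun k => ‖φ k‖ * R ^ k.natAbs)
    (hcoh : ∀ k, unitExp α ^ k * φ k = symbolCoeff b k + φ k) :
    ∃ g : X, g ≠ 0 ∧ (T : X →L[ℂ] X) g = c • g := by
  set F := laurentEval S φ with hF
  set Φ := laurentEval S (symbolCoeff b) with hΦ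
  have hd := summable_symbolCoeff hR hb
  -- T exp(-F) = exp(-Φ - F) T, and the factor exp(-Φ) cancels the exp(Φ) in Tv.
  refine ⟨NormedSpace.exp (-F) v, ?_, ?_⟩
  · intro h0
    apply hv0
    have : v = (NormedSpace.exp F * NormedSpace.exp (-F)) v := by rw [exp_mul_exp_neg]; rfl
    rw [this, mul_apply_eq_comp, h0, map_zero]
  · have hshift := mul_laurentEval hS (norm_unitExp α) hTS hφ
    have heq : laurentEval S (fun k => unitExp α ^ k * φ k) = Φ + F := by
      rw [hΦ, hF, ← laurentEval_add hS hd hφ]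
      congr 1
      funext k
      exact hcoh k
    rw [heq] at hshift
    have hneg : (T : X →L[ℂ] X) * (-F) = (-(Φ + F)) * T := by
      rw [mul_neg, hshift, neg_mul]
    have hexp := mul_exp_of_semiconj T hneg
    have hcomm : Commute Φ F := commute_laurentEval S _ _
    rw [← mul_apply_eq_comp, hexp, mul_apply_eq_comp, hv, map_smul,
      ← mul_apply_eq_comp, ← exp_add_of_commute_complex]
    · congr 3; abel
    · exact ((Commute.refl Φ).add_left hcomm.symm).neg_left

end Cocycle
end

/-! ### Solving the cohomological equation. -/

section
open Filter Topology

theorem isCoprime_of_abs_sub_eq_one {a b c d : ℤ} (h : |a * d - b * c| = 1) : IsCoprime a b := by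
  rcases (abs_eq zero_le_one).mp h with h | h
  · exact ⟨d, -c, by linarith⟩
  · exact ⟨-d, c, by linarith⟩

/-- The determinant identity gives 1 ≤ q|q'α - p'| + q'|qα - p|, and the first term is at most q/q''
≤ 1/2 because 2q ≤ q + q' ≤ q''. -/
theorem one_div_le_abs_of_convergents {α : ℝ} {q q' q'' : ℕ} {p p' : ℤ} (hq' : 0 < q')
    (hqq' : q ≤ q') (hq'' : q + q' ≤ q'') (happ : |q' * α - p'| ≤ 1 / q'')
    (hdet : |p * q' - q * p'| = 1) : 1 / (2 * (q' : ℝ)) ≤ |q * α - p| := by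
  have hq'R : (0 : ℝ) < q' := by exact_mod_cast hq'
  have hq''R : (0 : ℝ) < q'' := by exact_mod_cast (by omega : 0 < q'')
  have h1 : |((p * q' - q * p' : ℤ) : ℝ)| = 1 := by exact_mod_cast hdet
  have h2 : ((p * q' - q * p' : ℤ) : ℝ) = q * (q' * α - p') - q' * (q * α - p) := by push_cast; ring
  have h3 := abs_sub (q * (q' * α - p')) (q' * (q * α - p))
  rw [← h2, h1, abs_mul, abs_mul, abs_of_pos hq'R, abs_of_nonneg (Nat.cast_nonneg q)] at h3
  have h4 : (q : ℝ) * |q' * α - p'| ≤ 1 / 2 := by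
    calc (q : ℝ) * |q' * α - p'| ≤ q * (1 / q'') := by gcongr
      _ ≤ 1 / 2 := by
        rw [mul_one_div, div_le_div_iff₀ hq''R two_pos]
        have : q * 2 ≤ 1 * q'' := by omega
        exact_mod_cast this
  rw [div_le_iff₀ (by positivity)]
  linarith

theorem eventually_cofinite_natAbs_ge (K : ℕ) : ∀ᶠ k : ℤ in cofinite, K ≤ k.natAbs := by
  refine (Set.finite_Icc (-(K : ℤ)) K).subset fun k hk => ?_
  simp only [Set.mem_compl_iff, Set.mem_ofPred_eq, not_le] at hk
  rw [Set.mem_Icc]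
  omega

/-- The cohomological equation can be solved with exponentially decaying coefficients: at the
denominators of the convergents the resonant coefficients are small. -/
theorem summable_symbolCoeff_div {α : ℝ} {q : ℕ → ℕ} {p : ℕ → ℤ} (hqpos : ∀ n, 0 < q n)
    (hmono : ∀ n, q n ≤ q (n + 1)) (hadd : ∀ n, q n + q (n + 1) ≤ q (n + 2))
    (happ : ∀ n, |q n * α - p n| ≤ 1 / q (n + 1))
    (hdet : ∀ n, |p n * q (n + 1) - q n * p (n + 1)| = 1) (hq : Tendsto q atTop atTop)
    {b c : ℂ} {y γ R C σ : ℝ} (hb0 : b ≠ 0) (hR : 1 ≤ R) (hγ : 0 < γ)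
    (hbR : ‖b‖ * Real.exp γ * R < 1) (hc : ‖c‖ = 1)
    (hbc : (starRingEnd ℂ) b / b = c * unitExp y) (hC : 0 ≤ C) (hσ0 : 0 ≤ σ) (hσ1 : σ < 1)
    (hstep : ∀ n, ‖c ^ q n - 1‖ ≤
      C * (q n / q (n + 1) + ‖((starRingEnd ℂ) b / b) ^ q n - 1‖ * σ ^ q n))
    (hδ : ∀ᶠ n in atTop, ‖unitExp (q n * y) - 1‖ * q (n + 1) ≤ 2 * Real.pi * Real.exp (γ * q n)) :
    Summable fun k : ℤ => ‖symbolCoeff b k / (unitExp α ^ k - 1)‖ * R ^ k.natAbs := by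
  have hpi := Real.pi_pos
  have hqR : ∀ n, (0 : ℝ) < q n := fun n => by exact_mod_cast hqpos n
  have hcop : ∀ n, IsCoprime (p n) (q n : ℤ) := fun n => isCoprime_of_abs_sub_eq_one (hdet n)
  have hlow : ∀ n, 1 / (2 * (q (n + 1) : ℝ)) ≤ |q n * α - p n| := fun n =>
    one_div_le_abs_of_convergents (hqpos _) (hmono n) (hadd n) (happ (n + 1)) (hdet n)
  set M := 2 * C / γ + 4 * Real.pi with hM
  have hM0 : 0 ≤ M := by positivity
  have hs : ∀ᶠ n in atTop,
      ‖((starRingEnd ℂ) b / b) ^ q n - 1‖ * q (n + 1) ≤ M * Real.exp (γ * q n) := by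
    have hσlim : Tendsto (fun n => C * σ ^ q n) atTop (𝓝 0) := by
      simpa using ((tendsto_pow_atTop_nhds_zero_of_lt_one hσ0 hσ1).comp hq).const_mul C
    filter_upwards [hδ, hσlim.eventually_le_const (by norm_num : (0 : ℝ) < 1 / 2)] with n h1 h2
    set s := ‖((starRingEnd ℂ) b / b) ^ q n - 1‖ with hsdef
    have hs0 : 0 ≤ s := norm_nonneg _
    have h3 : s ≤ ‖c ^ q n - 1‖ + ‖unitExp (q n * y) - 1‖ := by
      have : ((starRingEnd ℂ) b / b) ^ q n - 1 =
          (c ^ q n - 1) + c ^ q n * (unitExp (q n * y) - 1) := by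
        rw [hbc, mul_pow, unitExp_natCast_mul]; ring
      rw [hsdef, this]
      refine (norm_add_le _ _).trans (le_of_eq ?_)
      rw [norm_mul, norm_pow, hc, one_pow, one_mul]
    -- The bound on c^q - 1 contains s itself, with coefficient Cσ^q ≤ 1/2 for large n, so it is
    -- absorbed on the left.
    have h4 := hstep n
    have h5 : s ≤ 2 * C * (q n / q (n + 1)) + 2 * ‖unitExp (q n * y) - 1‖ := by
      have : s * (C * σ ^ q n) ≤ s * (1 / 2) := mul_le_mul_of_nonneg_left h2 hs0
      linarith
    have h6 : γ * q n ≤ Real.exp (γ * q n) := by linarith [Real.add_one_le_exp (γ * q n)]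
    -- The remaining term 2C q_n is also bounded by a multiple of e^{γq_n}; this is where γ > 0 is
    -- needed.
    have h7 : (q n : ℝ) ≤ Real.exp (γ * q n) / γ := by rw [le_div_iff₀ hγ]; linarith
    calc s * q (n + 1)
        ≤ (2 * C * (q n / q (n + 1)) + 2 * ‖unitExp (q n * y) - 1‖) * q (n + 1) := by gcongr
      _ = 2 * C * q n + 2 * (‖unitExp (q n * y) - 1‖ * q (n + 1)) := by
        have := (hqR (n + 1)).ne'
        field_simp
      _ ≤ 2 * C * (Real.exp (γ * q n) / γ) + 2 * (2 * Real.pi * Real.exp (γ * q n)) := by gcongr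
      _ = M * Real.exp (γ * q n) := by rw [hM]; ring
  obtain ⟨n₀, hn₀⟩ := eventually_atTop.mp hs
  have hr0 : 0 ≤ ‖b‖ * Real.exp γ * R := by positivity
  refine Summable.of_norm_bounded_eventually
    ((summable_pow_natAbs hr0 hbR).mul_left (M + 2)) ?_
  filter_upwards [eventually_cofinite_natAbs_ge (q n₀)] with k hk
  have hqmono : Monotone q := monotone_nat_of_le_succ hmono
  have hex : ∃ n, 2 * k.natAbs ≤ q n := (hq.eventually_ge_atTop _).exists
  have hk0' : 0 < k.natAbs := lt_of_lt_of_le (hqpos n₀) hk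
  have hk0 : k ≠ 0 := Int.natAbs_pos.mp hk0'
  obtain ⟨n, hn0, hn1, hn2⟩ : ∃ n, n₀ ≤ n ∧ q n < 2 * k.natAbs ∧ 2 * k.natAbs ≤ q (n + 1) := by
    classical
    have h1 := Nat.find_spec hex
    have h2 : n₀ < Nat.find hex := by
      by_contra hle
      have := hqmono (not_lt.mp hle)
      omega
    obtain ⟨n, hn⟩ : ∃ n, Nat.find hex = n + 1 := ⟨Nat.find hex - 1, by omega⟩
    have h3 := Nat.find_min hex (m := n) (by omega)
    rw [hn] at h1
    exact ⟨n, by omega, by omega, h1⟩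
  have hkR : |(k : ℝ)| = (k.natAbs : ℝ) := by rw [Nat.cast_natAbs, Int.cast_abs]
  have hdiv := le_norm_unitExp_sub_one_of_le (hqpos n) (hqpos (n + 1)) (hcop n) (happ n) (hlow n)
    hk0 (by rw [hkR]; exact_mod_cast hn2)
  rw [unitExp_intCast_mul] at hdiv
  have hexp1 : 1 ≤ Real.exp γ ^ k.natAbs := one_le_pow₀ (Real.one_le_exp hγ.le)
  have hkey : ‖symbolCoeff b k / (unitExp α ^ k - 1)‖ ≤
      (M + 2) * (‖b‖ ^ k.natAbs * Real.exp γ ^ k.natAbs) := by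
    rw [norm_div]
    -- In the resonant case the divisor 2/q_{n+1} is paid for by the smallness of (b̄/b)^{q_n} - 1.
    -- Otherwise it is at least 2/q_n > 1/|k|, paid for by the 1/|k| in the coefficient.
    split_ifs at hdiv with hdvd
    · have h1 := norm_symbolCoeff_le_of_dvd hb0 (hqpos n) hk0 hdvd
      have h2 := hn₀ n hn0
      have hqk : q n ≤ k.natAbs := Nat.le_of_dvd hk0' (Int.natCast_dvd.mp hdvd)
      have hq1 : (1 : ℝ) ≤ q n := by exact_mod_cast hqpos n
      have hpos := hqR (n + 1)
      set s := ‖((starRingEnd ℂ) b / b) ^ q n - 1‖ with hsdef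
      calc ‖symbolCoeff b k‖ / ‖unitExp α ^ k - 1‖
          ≤ (‖b‖ ^ k.natAbs * s / q n) / (2 / q (n + 1)) := by gcongr
        _ = ‖b‖ ^ k.natAbs * (s * q (n + 1)) / (2 * q n) := by field_simp
        _ ≤ ‖b‖ ^ k.natAbs * (s * q (n + 1)) / 1 := by
          gcongr
          linarith
        _ ≤ ‖b‖ ^ k.natAbs * (M * Real.exp (γ * q n)) / 1 := by gcongr
        _ ≤ ‖b‖ ^ k.natAbs * ((M + 2) * Real.exp γ ^ k.natAbs) / 1 := by
          rw [← Real.exp_nat_mul, mul_comm (k.natAbs : ℝ) γ]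
          gcongr
          linarith
        _ = _ := by ring
    · have h1 := norm_symbolCoeff_mul_le b k
      have hkpos : (0 : ℝ) < k.natAbs := by exact_mod_cast hk0'
      have h2 : 1 / (k.natAbs : ℝ) ≤ ‖unitExp α ^ k - 1‖ := by
        refine le_trans ?_ hdiv
        rw [div_le_div_iff₀ hkpos (hqR n)]
        have : 1 * q n ≤ 2 * k.natAbs := by omega
        exact_mod_cast this
      rw [hkR] at h1
      calc ‖symbolCoeff b k‖ / ‖unitExp α ^ k - 1‖ ≤ ‖symbolCoeff b k‖ / (1 / k.natAbs) := by gcongr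
        _ = ‖symbolCoeff b k‖ * k.natAbs := by field_simp
        _ ≤ 2 * ‖b‖ ^ k.natAbs := h1
        _ ≤ (M + 2) * (‖b‖ ^ k.natAbs * Real.exp γ ^ k.natAbs) := by
          have : ‖b‖ ^ k.natAbs ≤ ‖b‖ ^ k.natAbs * Real.exp γ ^ k.natAbs :=
            le_mul_of_one_le_right (by positivity) hexp1
          gcongr
          linarith
  rw [Real.norm_of_nonneg (by positivity), mul_pow, mul_pow]
  calc ‖symbolCoeff b k / (unitExp α ^ k - 1)‖ * R ^ k.natAbs
      ≤ (M + 2) * (‖b‖ ^ k.natAbs * Real.exp γ ^ k.natAbs) * R ^ k.natAbs := by gcongr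
    _ = _ := by ring
end

/-! ### The operators S and T on weighted sequences. -/

open Filter Topology

/-- Bounded sequences indexed by `ℤ`. -/
abbrev BoundedSeq : Type := BoundedContinuousFunction ℤ ℂ

/-- The operator `x ↦ (n ↦ a n * x (σ n))` on bounded sequences, for bounded `a`. -/
noncomputable def weightedComp (a : ℤ → ℂ) (σ : ℤ → ℤ) {C : ℝ} (ha : ∀ n, ‖a n‖ ≤ C) :
    BoundedSeq →L[ℂ] BoundedSeq :=
  LinearMap.mkContinuous
    { toFun := fun x => BoundedContinuousFunction.ofNormedAddCommGroupDiscrete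
        (fun n => a n * x (σ n)) (C * ‖x‖) fun n => by
          rw [norm_mul]
          exact mul_le_mul (ha n) (x.norm_coe_le_norm _) (norm_nonneg _)
            ((norm_nonneg _).trans (ha 0))
      map_add' := fun x y => by
        ext n
        simp [mul_add]
      map_smul' := fun c x => by
        ext n
        simp [mul_left_comm] } C fun x => by
    refine (BoundedContinuousFunction.norm_le
      (mul_nonneg ((norm_nonneg _).trans (ha 0)) (norm_nonneg _))).mpr fun n => ?_
    change ‖a n * x (σ n)‖ ≤ _
    rw [norm_mul]
    exact mul_le_mul (ha n) (x.norm_coe_le_norm _) (norm_nonneg _) ((norm_nonneg _).trans (ha 0))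

theorem weightedComp_apply (a : ℤ → ℂ) (σ : ℤ → ℤ) {C : ℝ} (ha : ∀ n, ‖a n‖ ≤ C) (x : BoundedSeq)
    (n : ℤ) : weightedComp a σ ha x n = a n * x (σ n) := rfl

theorem norm_weightedComp_le (a : ℤ → ℂ) (σ : ℤ → ℤ) {C : ℝ} (ha : ∀ n, ‖a n‖ ≤ C) :
    ‖weightedComp a σ ha‖ ≤ C :=
  LinearMap.mkContinuous_norm_le _ ((norm_nonneg _).trans (ha 0)) _

theorem norm_weight_ratio_le {R : ℝ} (hR : 1 ≤ R) {m n : ℤ} (h : m.natAbs ≤ n.natAbs + 1) :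
    ‖((R ^ m.natAbs / R ^ n.natAbs : ℝ) : ℂ)‖ ≤ R := by
  have hR0 : 0 < R := by linarith
  rw [Complex.norm_real, Real.norm_of_nonneg (by positivity), div_le_iff₀ (by positivity),
    ← pow_succ']
  exact pow_le_pow_right₀ hR h

/-- The backward shift on sequences `u`, conjugated by the weight: `u n = R ^ |n| * x n`. -/
noncomputable def weightedShift {R : ℝ} (hR : 1 ≤ R) : (BoundedSeq →L[ℂ] BoundedSeq)ˣ where
  val := weightedComp (fun n => ((R ^ (n - 1).natAbs / R ^ n.natAbs : ℝ) : ℂ)) (fun n => n - 1)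
    (fun n => norm_weight_ratio_le hR (by omega))
  inv := weightedComp (fun n => ((R ^ (n + 1).natAbs / R ^ n.natAbs : ℝ) : ℂ)) (fun n => n + 1)
    (fun n => norm_weight_ratio_le hR (by omega))
  val_inv := by
    ext x n
    have hR0 : (R : ℂ) ≠ 0 := by exact_mod_cast (by linarith : R ≠ 0)
    rw [mul_apply_eq_comp, weightedComp_apply, weightedComp_apply, sub_add_cancel,
      one_apply_eq_self]
    push_cast
    field_simp
  inv_val := by
    ext x n
    have hR0 : (R : ℂ) ≠ 0 := by exact_mod_cast (by linarith : R ≠ 0)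
    rw [mul_apply_eq_comp, weightedComp_apply, weightedComp_apply, add_sub_cancel_right,
      one_apply_eq_self]
    push_cast
    field_simp

theorem norm_weightedShift_zpow_le {R : ℝ} (hR : 1 ≤ R) (k : ℤ) :
    ‖((weightedShift hR ^ k : (BoundedSeq →L[ℂ] BoundedSeq)ˣ) : BoundedSeq →L[ℂ] BoundedSeq)‖ ≤
      R ^ k.natAbs := by
  have hpow : ∀ (A : (BoundedSeq →L[ℂ] BoundedSeq)) (m : ℕ), ‖A‖ ≤ R → ‖A ^ m‖ ≤ R ^ m := by
    intro A m hA
    rcases Nat.eq_zero_or_pos m with rfl | hm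
    · rw [pow_zero, pow_zero]; exact ContinuousLinearMap.norm_id_le
    · exact (norm_pow_le' A hm).trans (pow_le_pow_left₀ (norm_nonneg _) hA m)
  obtain ⟨m, rfl | rfl⟩ := k.eq_nat_or_neg
  · rw [zpow_natCast, Units.val_pow_eq_pow_val, Int.natAbs_natCast]
    exact hpow _ _ (norm_weightedComp_le _ _ fun n => norm_weight_ratio_le hR (by omega))
  · rw [zpow_neg, ← inv_zpow, zpow_natCast, Units.val_pow_eq_pow_val, Int.natAbs_neg,
      Int.natAbs_natCast]
    exact hpow _ _ (norm_weightedComp_le _ _ fun n => norm_weight_ratio_le hR (by omega))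

/-- Multiplication by `exp (2 π i n α)`. -/
noncomputable def phaseMul (α : ℝ) : (BoundedSeq →L[ℂ] BoundedSeq)ˣ where
  val := weightedComp (fun n => unitExp (n * α)) id (fun n => (norm_unitExp _).le)
  inv := weightedComp (fun n => unitExp (-(n * α))) id (fun n => (norm_unitExp _).le)
  val_inv := by
    ext x n
    rw [mul_apply_eq_comp, weightedComp_apply, weightedComp_apply, ← mul_assoc, ← unitExp_add,
      one_apply_eq_self]
    simp [unitExp]
  inv_val := by
    ext x n
    rw [mul_apply_eq_comp, weightedComp_apply, weightedComp_apply, ← mul_assoc, ← unitExp_add,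
      one_apply_eq_self]
    simp [unitExp]

theorem phaseMul_apply (α : ℝ) (x : BoundedSeq) (n : ℤ) :
    (phaseMul α : BoundedSeq →L[ℂ] BoundedSeq) x n = unitExp (n * α) * x n := rfl

theorem phaseMul_pow_apply (α : ℝ) (N : ℕ) (x : BoundedSeq) (n : ℤ) :
    ((phaseMul α : BoundedSeq →L[ℂ] BoundedSeq) ^ N) x n = unitExp (N * (n * α)) * x n := by
  induction N with
  | zero => simp [unitExp]
  | succ N ih =>
    rw [pow_succ', mul_apply_eq_comp, phaseMul_apply, ih, ← mul_assoc, ← unitExp_add]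
    congr 2; push_cast; ring

theorem phaseMul_mul_weightedShift {R : ℝ} (hR : 1 ≤ R) (α : ℝ) :
    (phaseMul α : BoundedSeq →L[ℂ] BoundedSeq) * weightedShift hR =
      unitExp α • ((weightedShift hR : BoundedSeq →L[ℂ] BoundedSeq) * phaseMul α) := by
  ext x n
  change unitExp (n * α) * (_ * x (n - 1)) = unitExp α * (_ * (unitExp ((n - 1 : ℤ) * α) * x (n - 1)))
  have : unitExp (n * α) = unitExp α * unitExp ((n - 1 : ℤ) * α) := by
    rw [← unitExp_add]; congr 1; push_cast; ring
  rw [this]; simp only [id]; ring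

theorem one_sub_smul_mul_one_sub_smul_inv {A : Type*} [Ring A] [Algebra ℂ A] (S : Aˣ) (a : ℂ) :
    (1 - a • (S : A)) * (1 - a • ((S⁻¹ : Aˣ) : A)) =
      (1 + a ^ 2) • (1 : A) - a • ((S : A) + ((S⁻¹ : Aˣ) : A)) := by
  rw [mul_sub, sub_mul, sub_mul, one_mul, mul_one, smul_mul_smul_comm, Units.mul_inv, one_mul,
    smul_add, add_smul, one_smul, sq]
  abel

/-- The factorised symbol acts as a second difference operator. -/
theorem one_sub_smul_mul_apply {R : ℝ} (hR : 1 ≤ R) (a : ℂ) (x : BoundedSeq) (n : ℤ) :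
    ((1 - a • (weightedShift hR : BoundedSeq →L[ℂ] BoundedSeq)) *
      (1 - a • (((weightedShift hR)⁻¹ : (BoundedSeq →L[ℂ] BoundedSeq)ˣ) :
        BoundedSeq →L[ℂ] BoundedSeq))) x n =
      (1 + a ^ 2) * x n - a * (((R ^ (n - 1).natAbs / R ^ n.natAbs : ℝ) : ℂ) * x (n - 1)
        + ((R ^ (n + 1).natAbs / R ^ n.natAbs : ℝ) : ℂ) * x (n + 1)) := by
  have h : (1 - a • (weightedShift hR : BoundedSeq →L[ℂ] BoundedSeq)) *
      (1 - a • (((weightedShift hR)⁻¹ : (BoundedSeq →L[ℂ] BoundedSeq)ˣ) :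
        BoundedSeq →L[ℂ] BoundedSeq)) = (1 + a ^ 2) • 1 -
      a • ((weightedShift hR : BoundedSeq →L[ℂ] BoundedSeq) +
        (((weightedShift hR)⁻¹ : (BoundedSeq →L[ℂ] BoundedSeq)ˣ) : BoundedSeq →L[ℂ] BoundedSeq)) := by
    exact one_sub_smul_mul_one_sub_smul_inv _ a
  rw [h]
  rfl

/-- Polynomially bounded sequences are dominated by any exponential weight. -/
theorem PolynomiallyBounded.exists_bound {u : ℤ → ℂ} (hu : PolynomiallyBounded u) {R : ℝ}
    (hR : 1 < R) : ∃ C : ℝ, 0 ≤ C ∧ ∀ n m : ℤ, m.natAbs ≤ n.natAbs + 1 →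
      (1 + |(n : ℝ)|) * ‖u m‖ ≤ C * R ^ n.natAbs := by
  obtain ⟨C, hC⟩ := hu
  have hR0 : 0 < R := by linarith
  have hC0 : 0 ≤ C := by
    by_contra hneg
    have h1 := (norm_nonneg _).trans (hC 1)
    have h2 : C * (1 + |((1 : ℤ) : ℝ)| ^ C) < 0 := by
      refine mul_neg_of_neg_of_pos (not_le.mp hneg) (by positivity)
    linarith
  set K := ⌈C⌉₊ with hK
  have hbound : ∀ n : ℤ, ‖u n‖ ≤ 2 * C * (1 + |(n : ℝ)|) ^ K := by
    intro n
    have h1 : (1 : ℝ) ≤ 1 + |(n : ℝ)| := by linarith [abs_nonneg (n : ℝ)]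
    have h2 : |(n : ℝ)| ^ C ≤ (1 + |(n : ℝ)|) ^ K := by
      rw [← Real.rpow_natCast]
      exact (Real.rpow_le_rpow (abs_nonneg _) (by linarith) hC0).trans
        (Real.rpow_le_rpow_of_exponent_le h1 (Nat.le_ceil C))
    have h3 : (1 : ℝ) ≤ (1 + |(n : ℝ)|) ^ K := one_le_pow₀ h1
    calc ‖u n‖ ≤ C * (1 + |(n : ℝ)| ^ C) := hC n
      _ ≤ C * ((1 + |(n : ℝ)|) ^ K + (1 + |(n : ℝ)|) ^ K) := by gcongr
      _ = _ := by ring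
  -- The exponent K + 1 makes room for the extra factor 1 + |n|, needed later to differentiate the
  -- phase e(Nnα).
  obtain ⟨B, hB⟩ : ∃ B, ∀ m : ℕ, (m : ℝ) ^ (K + 1) / R ^ m ≤ B := by
    obtain ⟨B, hB⟩ := (tendsto_pow_const_div_const_pow_of_one_lt (K + 1) hR).bddAbove_range
    exact ⟨B, fun m => hB ⟨m, rfl⟩⟩
  have hB0 : 0 ≤ B := by
    have := hB 1
    refine le_trans (by positivity) this
  refine ⟨2 * C * B * R ^ 2, by positivity, fun n m hmn => ?_⟩
  have habs : ∀ k : ℤ, |(k : ℝ)| = (k.natAbs : ℝ) := fun k => by rw [Nat.cast_natAbs, Int.cast_abs]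
  have h1 := hB (n.natAbs + 2)
  rw [div_le_iff₀ (by positivity)] at h1
  push_cast at h1
  have hm : (m.natAbs : ℝ) ≤ n.natAbs + 1 := by exact_mod_cast hmn
  have hn0 : (0 : ℝ) ≤ n.natAbs := Nat.cast_nonneg _
  calc (1 + |(n : ℝ)|) * ‖u m‖
      ≤ (1 + |(n : ℝ)|) * (2 * C * (1 + |(m : ℝ)|) ^ K) := by gcongr; exact hbound m
    _ ≤ ((n.natAbs : ℝ) + 2) * (2 * C * ((n.natAbs : ℝ) + 2) ^ K) := by
      rw [habs, habs]
      gcongr ?_ * (_ * ?_ ^ K) <;> linarith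
    _ = 2 * C * ((n.natAbs : ℝ) + 2) ^ (K + 1) := by ring
    _ ≤ 2 * C * (B * R ^ (n.natAbs + 2)) := by gcongr
    _ = _ := by ring

/-! ### Cayley transform of the potential and the quantization condition. -/

theorem unitExp_mul_tan_add_I {t : ℝ} (ht : Real.cos (Real.pi * t) ≠ 0) :
    unitExp t * ((Real.tan (Real.pi * t) : ℂ) + Complex.I) =
      -((Real.tan (Real.pi * t) : ℂ) - Complex.I) := by
  have hexp : unitExp t =
      (Complex.cos (Real.pi * t) + Complex.sin (Real.pi * t) * Complex.I) ^ 2 := by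
    rw [unitExp, ← Complex.exp_mul_I, ← Complex.exp_nat_mul]
    congr 1; push_cast; ring
  have hc : Complex.cos (Real.pi * t) ≠ 0 := by
    rw [← Complex.ofReal_mul, ← Complex.ofReal_cos]
    exact_mod_cast ht
  rw [hexp]
  push_cast
  rw [Complex.tan_eq_sin_div_cos]
  have hcs := Complex.sin_sq_add_cos_sq (Real.pi * t)
  set c := Complex.cos (Real.pi * t)
  set s := Complex.sin (Real.pi * t)
  have hI := Complex.I_sq
  rw [div_add' _ _ _ hc, mul_div_assoc', div_sub' hc, ← neg_div]
  congr 1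
  linear_combination (2 * c ^ 2 * s + s ^ 3 + s ^ 2 * c * Complex.I) * hI + (Complex.I * c - s) * hcs

/-- e(arg μ/π) = exp(2i arg μ) = μ/μ̄. This links the density of states to the symbol with parameter
b = 1/μ. -/
theorem unitExp_arg_div_pi {μ : ℂ} (hμ : μ ≠ 0) :
    unitExp (μ.arg / Real.pi) = (starRingEnd ℂ) μ⁻¹ / μ⁻¹ := by
  have hn : (‖μ‖ : ℂ) ≠ 0 := by exact_mod_cast norm_ne_zero_iff.mpr hμ
  have hpi : (Real.pi : ℂ) ≠ 0 := by exact_mod_cast Real.pi_ne_zero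
  have h1 := Complex.norm_mul_exp_arg_mul_I μ
  have h2 : (starRingEnd ℂ) μ = ‖μ‖ * Complex.exp (-(μ.arg * Complex.I)) := by
    conv_lhs => rw [← h1]
    rw [map_mul, Complex.conj_ofReal, ← Complex.exp_conj, map_mul, Complex.conj_ofReal,
      Complex.conj_I]
    congr 2; ring
  have h3 : (starRingEnd ℂ) μ⁻¹ / μ⁻¹ = μ / (starRingEnd ℂ) μ := by
    rw [map_inv₀]; field_simp
  have h4 : μ / (‖μ‖ * Complex.exp (-(μ.arg * Complex.I))) =
      (‖μ‖ * Complex.exp (μ.arg * Complex.I)) / (‖μ‖ * Complex.exp (-(μ.arg * Complex.I))) := by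
    rw [h1]
  rw [h3, h2, h4, mul_div_mul_left _ _ hn, ← Complex.exp_sub, unitExp]
  congr 1
  push_cast
  field_simp
  ring

theorem eventually_norm_unitExp_mul_le {α θ γ : ℝ} {q : ℕ → ℕ} (hq : ∀ n, cfDen α n = q n)
    (hqpos : ∀ n, 0 < q n) (hδ : marylandDelta α θ < ((γ : ℝ) : EReal)) :
    ∀ᶠ n in atTop, ‖unitExp (q n * (θ - 1 / 2)) - 1‖ * q (n + 1) ≤
      2 * Real.pi * Real.exp (γ * q n) := by
  have hev := eventually_lt_of_limsup_lt hδ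
  filter_upwards [hev] with n hn
  rw [hq, hq, UnitAddCircle.norm_eq] at hn
  set x : ℝ := q n * (θ - 1 / 2) with hx
  set d := |x - round x| with hd
  have hqR : (0 : ℝ) < q n := by exact_mod_cast hqpos n
  have hqR' : (0 : ℝ) < q (n + 1) := by exact_mod_cast hqpos (n + 1)
  have h1 := norm_unitExp_sub_one_le x (round x)
  have hpi := Real.pi_pos
  have hmain : d * q (n + 1) ≤ Real.exp (γ * q n) := by
    -- When the distance is zero its logarithm is -∞, and the bound holds trivially.
    rcases (abs_nonneg (x - round x)).eq_or_lt with h0 | hpos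
    · rw [hd, ← h0, zero_mul]; positivity
    · have hlog : ENNReal.log (ENNReal.ofReal d) = ((Real.log d : ℝ) : EReal) := by
        rw [ENNReal.log_ofReal_of_pos hpos]
      rw [hlog, ← EReal.coe_add, ← EReal.coe_div, EReal.coe_lt_coe_iff, div_lt_iff₀ hqR,
        ← Real.log_mul hpos.ne' hqR'.ne'] at hn
      exact ((Real.log_lt_iff_lt_exp (by positivity)).mp hn).le
  calc ‖unitExp x - 1‖ * q (n + 1) ≤ 2 * Real.pi * d * q (n + 1) := by gcongr
    _ = 2 * Real.pi * (d * q (n + 1)) := by ring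
    _ ≤ _ := by gcongr

theorem proposition3p1 (lam α θ e : ℝ) (hlam : 0 < lam) (hα : Irrational α)
    (hθ : ∀ m n : ℤ, θ ≠ 1 / 2 + m * α + n)
    (hγ : marylandDelta α θ < ((lyapunovExponent lam α e : ℝ) : EReal))
    (hu : ∃ u : ℤ → ℂ, u ≠ 0 ∧ PolynomiallyBounded u ∧
      marylandOp lam α θ u = fun n => (e : ℂ) * u n) :
    ∃ m n : ℤ, integratedDensityOfStates lam α e = θ + 1 / 2 + m * α + n := by
  obtain ⟨u, hu0, hupoly, hueq⟩ := hu
  obtain ⟨μ, hμ1, hμim, hμ⟩ := exists_dominant_eigenvalue lam e hlam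
  have hμ0 : μ ≠ 0 := (one_lt_norm_sub_inv_ne_zero hμ1).1
  rw [lyapunovExponent_eq hlam α hμ1 hμ] at hγ
  have hlogpos : 0 < Real.log ‖μ‖ := Real.log_pos hμ1
  -- an exponent strictly between `δ` and the Lyapunov exponent
  obtain ⟨γ, hγ0, hγδ, hγμ⟩ : ∃ γ : ℝ, 0 < γ ∧ marylandDelta α θ < (γ : EReal) ∧
      γ < Real.log ‖μ‖ := by
    -- Since δ may be negative or -∞, γ is taken above max(δ, 0).
    obtain ⟨z, hz1, hz2⟩ := EReal.lt_iff_exists_real_btwn.mp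
      (max_lt hγ (by exact_mod_cast hlogpos : ((0 : ℝ) : EReal) < ((Real.log ‖μ‖ : ℝ) : EReal)))
    exact ⟨z, by exact_mod_cast (le_max_right _ _).trans_lt hz1, (le_max_left _ _).trans_lt hz1,
      by exact_mod_cast hz2⟩
  set b : ℂ := μ⁻¹ with hb
  have hb0 : b ≠ 0 := inv_ne_zero hμ0
  have hbγ : ‖b‖ * Real.exp γ < 1 := by
    rw [hb, norm_inv, inv_mul_lt_iff₀ (by linarith), mul_one]
    calc Real.exp γ < Real.exp (Real.log ‖μ‖) := Real.exp_lt_exp.mpr hγμ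
      _ = ‖μ‖ := Real.exp_log (by linarith)
  obtain ⟨R, hR1, hbR⟩ : ∃ R : ℝ, 1 < R ∧ ‖b‖ * Real.exp γ * R < 1 := by
    have h1 : ∀ᶠ R : ℝ in 𝓝[>] 1, ‖b‖ * Real.exp γ * R < 1 := by
      have : Tendsto (fun R : ℝ => ‖b‖ * Real.exp γ * R) (𝓝[>] 1) (𝓝 (‖b‖ * Real.exp γ * 1)) :=
        ((continuous_const_mul (‖b‖ * Real.exp γ)).tendsto 1).mono_left nhdsWithin_le_nhds
      exact this.eventually_lt_const (by simpa using hbγ)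
    obtain ⟨R, h2, h3⟩ := (h1.and self_mem_nhdsWithin).exists
    exact ⟨R, h3, h2⟩
  have hR0 : 0 < R := by linarith
  have hbR' : ‖b‖ * R < 1 := by
    refine lt_of_le_of_lt ?_ hbR
    gcongr
    exact le_mul_of_one_le_right (norm_nonneg _) (Real.one_le_exp hγ0.le)
  set S := weightedShift hR1.le
  set T := phaseMul α
  have hS := norm_weightedShift_zpow_le hR1.le
  have hTS := phaseMul_mul_weightedShift hR1.le α
  obtain ⟨D, hD0, hD⟩ := hupoly.exists_bound hR1
  -- the weighted sequence
  have hw : ∀ n : ℤ, ((R ^ n.natAbs : ℝ) : ℂ) ≠ 0 := fun n => by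
    exact_mod_cast (pow_pos hR0 _).ne'
  let x : BoundedSeq := BoundedContinuousFunction.ofNormedAddCommGroupDiscrete
    (fun n => u n / ((R ^ n.natAbs : ℝ) : ℂ)) D fun n => by
      rw [norm_div, Complex.norm_real, Real.norm_of_nonneg (by positivity),
        div_le_iff₀ (by positivity)]
      refine le_trans ?_ (hD n n (by omega))
      exact le_mul_of_one_le_left (norm_nonneg _) (by linarith [abs_nonneg (n : ℝ)])
  have hx : ∀ n, x n = u n / ((R ^ n.natAbs : ℝ) : ℂ) := fun _ => rfl
  have hfac : ∀ (a : ℂ) (n : ℤ), ((1 - a • (S : BoundedSeq →L[ℂ] BoundedSeq)) *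
      (1 - a • ((S⁻¹ : (BoundedSeq →L[ℂ] BoundedSeq)ˣ) : BoundedSeq →L[ℂ] BoundedSeq))) x n =
      ((1 + a ^ 2) * u n - a * (u (n - 1) + u (n + 1))) / ((R ^ n.natAbs : ℝ) : ℂ) := by
    intro a n
    rw [one_sub_smul_mul_apply, hx, hx, hx]
    have h1 := hw n
    have h2 := hw (n - 1)
    have h3 := hw (n + 1)
    rw [Complex.ofReal_div, Complex.ofReal_div]
    field_simp
  set t : ℤ → ℝ := fun n => Real.tan (Real.pi * (θ + n * α)) with ht
  have heq : ∀ n, u (n - 1) + u (n + 1) = (e - lam * t n) * u n := by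
    intro n
    have := congrFun hueq n
    simp only [marylandOp] at this
    push_cast at this
    simp only [ht, Complex.ofReal_tan]
    push_cast
    linear_combination this
  -- With this, (1 - bS)(1 - bS⁻¹)u = bλ(t - i)u, and its conjugate counterpart is b̄λ(t + i)u.
  have hbb : 1 + b ^ 2 = b * (e - Complex.I * lam) := by
    rw [← hμ, hb]; field_simp
  have hbb' : 1 + (starRingEnd ℂ) b ^ 2 = (starRingEnd ℂ) b * (e + Complex.I * lam) := by
    have := congrArg (starRingEnd ℂ) hbb
    simp only [map_add, map_one, map_pow, map_mul, map_sub, Complex.conj_ofReal, Complex.conj_I]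
      at this
    rw [this]; ring
  set v : BoundedSeq := ((1 - (starRingEnd ℂ) b • (S : BoundedSeq →L[ℂ] BoundedSeq)) *
      (1 - (starRingEnd ℂ) b • ((S⁻¹ : (BoundedSeq →L[ℂ] BoundedSeq)ˣ) :
        BoundedSeq →L[ℂ] BoundedSeq))) x with hvdef
  have hvn : ∀ n, v n = (starRingEnd ℂ) b * lam * (t n + Complex.I) * u n
      / ((R ^ n.natAbs : ℝ) : ℂ) := by
    intro n
    rw [hvdef, hfac, hbb', heq]
    congr 1; ring
  -- Chosen so that b̄/b = c e(θ - 1/2); the theorem is equivalent to c being an integer power of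
  -- e(α).
  set c : ℂ := unitExp (μ.arg / Real.pi - (θ - 1 / 2)) with hc
  have hc1 : ‖c‖ = 1 := norm_unitExp _
  have hbc : (starRingEnd ℂ) b / b = c * unitExp (θ - 1 / 2) := by
    rw [hc, ← unitExp_add, hb, ← unitExp_arg_div_pi hμ0, sub_add_cancel]
  have hcos : ∀ n : ℤ, Real.cos (Real.pi * (θ + n * α)) ≠ 0 := by
    intro n h0
    obtain ⟨k, hk⟩ := Real.cos_eq_zero_iff.mp h0
    apply hθ (-n) k
    have h1 : θ + n * α = (2 * k + 1) / 2 := by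
      apply mul_left_cancel₀ Real.pi_ne_zero
      rw [hk]; ring
    push_cast
    linarith
  -- Pointwise this is the Cayley identity e(θ + nα)(t + i) = -(t - i); the sign is the 1/2 in θ -
  -- 1/2.
  have hv : (T : BoundedSeq →L[ℂ] BoundedSeq) v =
      c • NormedSpace.exp (laurentEval (𝔸 := BoundedSeq →L[ℂ] BoundedSeq) S (symbolCoeff b)) v := by
    ext n
    rw [hvdef, ← mul_apply_eq_comp (NormedSpace.exp _), exp_laurentEval_symbolCoeff hS hbR',
      ← hvdef]
    rw [phaseMul_apply, hvn, BoundedContinuousFunction.smul_apply, hfac, hbb, heq, smul_eq_mul]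
    have h1 := unitExp_mul_tan_add_I (hcos n)
    have h2 : unitExp (θ + n * α) = unitExp (θ - 1 / 2) * -1 * unitExp (n * α) := by
      have h3 : unitExp (1 / 2) = -1 := by
        rw [unitExp, show 2 * Real.pi * Complex.I * ((1 / 2 : ℝ) : ℂ) = Real.pi * Complex.I by
          push_cast; ring, Complex.exp_pi_mul_I]
      rw [← h3, ← unitExp_add, ← unitExp_add]
      congr 1; ring
    have h4 : (starRingEnd ℂ) b = c * unitExp (θ - 1 / 2) * b := by
      rw [← hbc, div_mul_cancel₀ _ hb0]
    rw [h2] at h1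
    rw [h4, mul_div_assoc', mul_div_assoc']
    congr 1
    simp only [ht]
    linear_combination (-(c * b * lam * u n)) * h1
  -- Since t is real, t + i never vanishes, so v vanishes only where u does.
  have hv0 : v ≠ 0 := by
    intro h0
    apply hu0
    funext n
    have h1 := hvn n
    rw [h0, BoundedContinuousFunction.coe_zero, Pi.zero_apply, eq_comm,
      div_eq_zero_iff, or_iff_left (hw n)] at h1
    have h2 : (t n : ℂ) + Complex.I ≠ 0 := by
      intro h3
      have := congrArg Complex.im h3
      simp at this
    have h4 : (starRingEnd ℂ) b ≠ 0 := by simpa using hb0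
    have h5 : (lam : ℂ) ≠ 0 := by exact_mod_cast hlam.ne'
    simpa [h2, h4, h5] using h1
  -- |e(Nnα) - 1| ≤ 2π|n||Nα - p|, and the factor |n| is absorbed because (1 + |n|)|v n| is still
  -- bounded.
  obtain ⟨C₁, hT⟩ : ∃ C₁ : ℝ, ∀ (N : ℕ) (p : ℤ),
      ‖((T : BoundedSeq →L[ℂ] BoundedSeq) ^ N) v - v‖ ≤ C₁ * |N * α - p| := by
    set B := ‖1 + (starRingEnd ℂ) b ^ 2‖ * D + ‖(starRingEnd ℂ) b‖ * (D + D) with hB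
    have hB0 : 0 ≤ B := by positivity
    have hvB : ∀ n : ℤ, (1 + |(n : ℝ)|) * ‖v n‖ ≤ B := by
      intro n
      rw [hvdef, hfac, norm_div, Complex.norm_real, Real.norm_of_nonneg (by positivity),
        mul_div_assoc', div_le_iff₀ (by positivity)]
      have h1 := hD n n (by omega)
      have h2 := hD n (n - 1) (by omega)
      have h3 := hD n (n + 1) (by omega)
      have h0 : 0 ≤ 1 + |(n : ℝ)| := by positivity
      calc (1 + |(n : ℝ)|) * ‖(1 + (starRingEnd ℂ) b ^ 2) * u n
            - (starRingEnd ℂ) b * (u (n - 1) + u (n + 1))‖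
          ≤ (1 + |(n : ℝ)|) * (‖1 + (starRingEnd ℂ) b ^ 2‖ * ‖u n‖
            + ‖(starRingEnd ℂ) b‖ * (‖u (n - 1)‖ + ‖u (n + 1)‖)) := by
            gcongr
            refine (norm_sub_le _ _).trans ?_
            rw [norm_mul, norm_mul]
            gcongr
            exact norm_add_le _ _
        _ = ‖1 + (starRingEnd ℂ) b ^ 2‖ * ((1 + |(n : ℝ)|) * ‖u n‖) + ‖(starRingEnd ℂ) b‖ *
            ((1 + |(n : ℝ)|) * ‖u (n - 1)‖ + (1 + |(n : ℝ)|) * ‖u (n + 1)‖) := by ring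
        _ ≤ ‖1 + (starRingEnd ℂ) b ^ 2‖ * (D * R ^ n.natAbs) + ‖(starRingEnd ℂ) b‖ *
            (D * R ^ n.natAbs + D * R ^ n.natAbs) := by gcongr
        _ = B * R ^ n.natAbs := by rw [hB]; ring
    refine ⟨2 * Real.pi * B, fun N p => ?_⟩
    have hpi := Real.pi_pos
    refine (BoundedContinuousFunction.norm_le (by positivity)).mpr fun n => ?_
    rw [BoundedContinuousFunction.coe_sub, Pi.sub_apply, phaseMul_pow_apply]
    have h1 : unitExp (N * (n * α)) * v n - v n = (unitExp (N * (n * α)) - 1) * v n := by ring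
    rw [h1, norm_mul]
    have h2 := norm_unitExp_sub_one_le (N * (n * α)) (n * p)
    have h3 : (N : ℝ) * (n * α) - ((n * p : ℤ) : ℝ) = n * (N * α - p) := by push_cast; ring
    rw [h3, abs_mul] at h2
    have h4 : |(n : ℝ)| * ‖v n‖ ≤ B := by
      refine le_trans ?_ (hvB n)
      gcongr
      linarith
    calc ‖unitExp (N * (n * α)) - 1‖ * ‖v n‖
        ≤ 2 * Real.pi * (|(n : ℝ)| * |N * α - p|) * ‖v n‖ := by gcongr
      _ = 2 * Real.pi * (|(n : ℝ)| * ‖v n‖) * |N * α - p| := by ring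
      _ ≤ _ := by gcongr
  obtain ⟨C, σ, hC0, hσ0, hσ1, hstep⟩ :=
    exists_norm_pow_sub_one_le hR1.le hS hTS hb0 hbR' hc1 hv0 hv hT
  obtain ⟨q, p, hcf, hqpos, hmono, hadd, happ, hdet, hqlim⟩ := exists_convergents hα
  have hsum := summable_symbolCoeff_div hqpos hmono hadd happ hdet hqlim hb0 hR1.le hγ0 hbR hc1 hbc
    hC0 hσ0 hσ1
    (fun n => hstep (q n) (q (n + 1)) (p n) (hqpos n) (hmono n)
      (isCoprime_of_abs_sub_eq_one (hdet n)) (happ n))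
    (eventually_norm_unitExp_mul_le hcf hqpos hγδ)
  obtain ⟨g, hg0, hg⟩ := exists_eigenvector_of_cohomology hR0.le hS hTS hbR' hv0 hv hsum (by
    intro k
    rcases eq_or_ne k 0 with rfl | hk
    · simp [symbolCoeff]
    · have hne : unitExp α ^ k - 1 ≠ 0 := by
        rw [sub_ne_zero, ← unitExp_intCast_mul]
        intro h1
        have h2 : unitExp (k * α) = unitExp 0 := by rw [h1]; simp [unitExp]
        obtain ⟨m, hm⟩ := (unitExp_eq_unitExp_iff _ _).mp h2
        refine (hα.intCast_mul hk).ne_int m ?_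
        rw [hm, zero_add]
      field_simp
      ring)
  -- T is diagonal, so wherever g does not vanish its eigenvalue c equals e(nα).
  obtain ⟨n, hn⟩ : ∃ n, g n ≠ 0 := by
    by_contra hall
    push Not at hall
    exact hg0 (by ext n; exact hall n)
  have h1 : unitExp (n * α) * g n = c * g n := by
    have := congrArg (fun h : BoundedSeq => h n) hg
    simpa [phaseMul_apply, T] using this
  have h2 := mul_right_cancel₀ hn h1
  obtain ⟨m, hm⟩ := (unitExp_eq_unitExp_iff _ _).mp h2.symm
  refine ⟨n, m, ?_⟩
  rw [integratedDensityOfStates_eq hlam α hμ1 hμim hμ]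
  linarith
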